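/- Let $\mathbb H^1$ be $\mathbb R^3$ with the Heisenberg product $$x\odot w=\bigl(x_1+w_1,\;x_2+w_2,\;x_3+w_3+\tfrac12(x_1w_2-x_2w_1)\bigr).$$ Let $I=[\alpha,\beta]$ with $\alpha<\beta$, let $\gamma_2,\gamma_3\in C^\infty(\mathbb R)$ be real-valued, and let $\gamma(t)=(t,\gamma_2(t),\gamma_3(t))$. Assume that for all $t\in I$ $$\gamma_2''(t)\neq 0\qquad\text{and}\qquad \det\begin{pmatrix}\gamma_2''(t)&\gamma_3''(t)\\ \gamma_2'''(t)&\gamma_3'''(t)\end{pmatrix}=\tfrac12\,(\gamma_2''(t))^2 .$$ Let $a\in C^\infty(\mathbb R;\mathbb C)$ be not identically zero on $I$ and put $d\mu(t)=a(t)\mathbf 1_I(t)\,dt$ and $$Af(x)=\int f(\gamma(t)^{-1}\odot x)\,d\mu(t).$$ For $1\le p\le\infty$ and $s\in\mathbb R$, let $L^p_s(\mathbb R^3)$ be the Sobolev space with norm $\|u\|_{L^p_s}=\|D^su\|_{L^p}$, where $\widehat{D^su}(\xi)=(1+|\xi|^2)^{s/2}\,\widehat u(\xi)$. Suppose that $A$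 is bounded from $L^p_{comp}(\mathbb R^3)$ to $L^p_s(\mathbb R^3)$, that is, for every compact $K\subset\mathbb R^3$ there is a constant $C_K$ such that $Af\in L^p_s(\mathbb R^3)$ and $\|Af\|_{L^p_s}\le C_K\|f\|_{L^p}$ for all $f\in L^p(\mathbb R^3)$ that vanish outside $K$. Then $$s\le\min\Bigl\{\tfrac1p,\;\tfrac12\bigl(1-\tfrac1p\bigr)\Bigr\},$$ where $1/\infty=0$. -/

import Mathlib

open MeasureTheory
open scoped ContDiff ENNReal

noncomputable section

/-- The underlying space `ℝ³` (with Euclidean norm and Lebesgue measure) of the Heisenberg group. -/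
abbrev HeisSpace : Type := EuclideanSpace ℝ (Fin 3)

/-- The Heisenberg product
`x ⊙ w = (x₁ + w₁, x₂ + w₂, x₃ + w₃ + ½ (x₁ w₂ - x₂ w₁))`. -/
def heisMul (x w : HeisSpace) : HeisSpace :=
  !₂[x 0 + w 0, x 1 + w 1, x 2 + w 2 + 1 / 2 * (x 0 * w 1 - x 1 * w 0)]

/-- The inverse for the Heisenberg product (see `heisInv_heisMul_self`, `heisMul_heisInv_self`). -/
def heisInv (x : HeisSpace) : HeisSpace := -x

theorem heisInv_heisMul_self (x : HeisSpace) : heisMul (heisInv x) x = 0 := by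
  ext i
  fin_cases i <;> simp [heisMul, heisInv] <;> ring

theorem heisMul_heisInv_self (x : HeisSpace) : heisMul x (heisInv x) = 0 := by
  ext i
  fin_cases i <;> simp [heisMul, heisInv] <;> ring

/-- The curve `t ↦ (t, γ₂ t, γ₃ t)`. -/
def heisCurve (γ₂ γ₃ : ℝ → ℝ) (t : ℝ) : HeisSpace := !₂[t, γ₂ t, γ₃ t]

/-- The averaging operator `A f (x) = ∫ f (γ(t)⁻¹ ⊙ x) dμ(t)` along the curve `γ` over the
parameter interval `[α, β]`, where `dμ(t) = a(t) dt`. -/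
def heisAverage (γ : ℝ → HeisSpace) (a : ℝ → ℂ) (α β : ℝ) (f : HeisSpace → ℂ)
    (x : HeisSpace) : ℂ :=
  ∫ t in Set.Icc α β, a t * f (heisMul (heisInv (γ t)) x)

/-- The function `F` on `ℝ³` belongs to the (Bessel potential) Sobolev space `L^p_s(ℝ³)` with norm
at most `C`: its class `u` lies in `L^p`, the tempered distribution with Fourier transform
`(1 + |ξ|²)^(s/2) û(ξ)` is given by a function `g` in `L^p`, and `‖g‖_p ≤ C`. -/
def SobolevNormLE (s : ℝ) (p : ℝ≥0∞) [Fact (1 ≤ p)] (F : HeisSpace → ℂ) (C : ℝ) : Prop :=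
  ∃ u g : Lp ℂ p (volume : Measure HeisSpace),
    u =ᵐ[volume] F ∧
    TemperedDistribution.besselPotential HeisSpace ℂ s (Lp.toTemperedDistribution u) =
      Lp.toTemperedDistribution g ∧
    ‖g‖ ≤ C

/-- `T` is bounded from `L^p_comp(ℝ³)` to `L^p_s(ℝ³)`: for each compact `K` there is a constant `C`
such that `‖T f‖_{L^p_s} ≤ C ‖f‖_p` for all `f ∈ L^p` vanishing outside `K`. -/
def BoundedLpCompToSobolev (T : (HeisSpace → ℂ) → (HeisSpace → ℂ)) (p : ℝ≥0∞) [Fact (1 ≤ p)]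
    (s : ℝ) : Prop :=
  ∀ K : Set HeisSpace, IsCompact K → ∃ C : ℝ, ∀ f : HeisSpace → ℂ,
    MemLp f p volume → Function.support f ⊆ K →
      SobolevNormLE s p (T f) (C * (eLpNorm f p volume).toReal)

end

/-! Each of the two bounds comes from a family of functions `f` at a scale tending to 0: a pairing
of `A f` with a test function is bounded below and above by powers of the scale, and the exponents
are compared (`exponent_le_of_eventually_le`).

Upper bound. Take `ψ = 𝓕 χ` with `χ` supported where `η₃ ≥ 1/4`, and precompose it with `x ↦
heisShear R e u v (x - x₀)`. For bounded `e, u, v` all its frequencies then have size about `R`.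
Moving the Bessel potential across the pairing therefore costs exactly `R ^ (-s)` and replaces `ψ`
by another function that decays rapidly, uniformly in the parameters
(`integral_mul_fourier_heisShear_eq`, `exists_decay_besselSymbol`). What remains is `∫ |g| W` with
`‖g‖_p ≲ ‖f‖_p` and a weight `W` of known supremum and mass, to which Hölder applies
(`lintegral_enorm_mul_le_of_le`).

Lower bound. Two times `t, t'` occur, one from `A` and one from a superposition along the curve.
Substituting `t' = t + ε r` turns the pairing into a power of the scale times an integral that
converges by dominated convergence (`exists_pairing_lower_bound`). The limit is nonzero because `𝓕 χ
≥ 0` on the plane `y₃ = 0`, and the limiting relative position of two nearby curve points lies in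
that plane for `t = t₀`, `w = 0`.

Tube example, `s ≤ 1/p`: `f` is bounded and lives on the `δ`-neighbourhood of `t ↦ γ(t)⁻¹`, so
`‖f‖_p ≲ δ ^ (2/p)`, while its pairing with a test function at scale `δ` at the origin has size `δ ^
3`.

Horizontal example, `s ≤ (1 - 1/p)/2`: the determinant condition integrates to `γ₃' = d + c γ₂' + (t
γ₂' - γ₂)/2`, so up to a shear the curve is tangent to the contact planes of the group. Hence left
translates along the curve of an `ε × ε × ε²` box at times `ε` apart stay comparable. Testing at
frequency `ε⁻²` gives `ε ^ (2s)`, the source of the factor `1/2`. -/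

open FourierTransform

/-! ### Uniform decay of Fourier transforms -/

/-- The Fourier transforms of a smooth family of functions with common compact support decay
rapidly, uniformly on compact sets of parameters. -/
theorem exists_forall_norm_fourier_mul_pow_le {Θ V : Type*} [NormedAddCommGroup Θ]
    [NormedSpace ℝ Θ] [NormedAddCommGroup V] [InnerProductSpace ℝ V] [FiniteDimensional ℝ V]
    [MeasurableSpace V] [BorelSpace V] {F : Θ × V → ℂ} (hF : ContDiff ℝ ∞ F) {K : Set Θ}
    (hK : IsCompact K) {B : Set V} (hB : IsCompact B) (hFB : ∀ θ η, η ∉ B → F (θ, η) = 0) (N : ℕ) :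
    ∃ C : ℝ, 0 ≤ C ∧ ∀ θ ∈ K, ∀ y, ‖𝓕 (fun η => F (θ, η)) y‖ * (1 + ‖y‖) ^ N ≤ C := by
  have hsm : ∀ θ, ContDiff ℝ ∞ (fun η => F (θ, η)) := fun θ => hF.comp (by fun_prop)
  -- A derivative along the fibre is the joint derivative restricted through the inclusion of the
  -- second factor, which has norm at most 1; joint continuity on `K ×ˢ B` then gives uniformity in
  -- `θ`.
  have hder : ∀ n θ η, ‖iteratedFDeriv ℝ n (fun η => F (θ, η)) η‖
      ≤ ‖iteratedFDeriv ℝ n F (θ, η)‖ := by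
    intro n θ η
    have h1 : (fun η => F (θ, η)) = (fun p => F ((θ, 0) + p)) ∘ (ContinuousLinearMap.inr ℝ Θ V) := by
      ext; simp
    have h2 : ContDiff ℝ ∞ (fun p => F ((θ, 0) + p)) := hF.comp (by fun_prop)
    rw [h1, ContinuousLinearMap.iteratedFDeriv_comp_right _ h2 _
      (by exact_mod_cast le_top), iteratedFDeriv_comp_add_left]
    refine (ContinuousMultilinearMap.norm_compContinuousLinearMap_le _ _).trans ?_
    have : ∏ i : Fin n, ‖ContinuousLinearMap.inr ℝ Θ V‖ ≤ 1 :=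
      Finset.prod_le_one (fun _ _ => norm_nonneg (ContinuousLinearMap.inr ℝ Θ V))
        (fun _ _ => ContinuousLinearMap.norm_inr_le_one ℝ Θ V)
    calc _ ≤ _ * (1 : ℝ) := mul_le_mul_of_nonneg_left this (norm_nonneg _)
      _ = _ := by simp
  have hcs : ∀ θ, tsupport (fun η => F (θ, η)) ⊆ B := fun θ =>
    closure_minimal (fun η hη => by by_contra h; exact hη (hFB θ η h)) hB.isClosed
  have hder0 : ∀ n θ η, η ∉ B → iteratedFDeriv ℝ n (fun η => F (θ, η)) η = 0 := by
    intro n θ η hη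
    by_contra h
    exact hη (hcs θ (support_iteratedFDeriv_subset n h))
  have hbd : ∀ n : ℕ, ∃ C : ℝ, 0 ≤ C ∧ ∀ θ ∈ K, ∀ η,
      ‖iteratedFDeriv ℝ n (fun η => F (θ, η)) η‖ ≤ B.indicator (fun _ => C) η := by
    intro n
    have hc : Continuous (iteratedFDeriv ℝ n F) :=
      hF.continuous_iteratedFDeriv (by exact_mod_cast le_top)
    obtain ⟨C, hC⟩ := (hK.prod hB).exists_bound_of_continuousOn hc.continuousOn
    refine ⟨max C 0, le_max_right _ _, fun θ hθ η => ?_⟩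
    by_cases hη : η ∈ B
    · rw [Set.indicator_of_mem hη]
      exact ((hder n θ η).trans (hC _ ⟨hθ, hη⟩)).trans (le_max_left _ _)
    · rw [hder0 n θ η hη, Set.indicator_of_notMem hη]; simp
  have hint : ∀ θ (k n : ℕ),
      Integrable (fun v => ‖v‖ ^ k * ‖iteratedFDeriv ℝ n (fun η => F (θ, η)) v‖) := by
    intro θ k n
    have hc : Continuous (iteratedFDeriv ℝ n (fun η => F (θ, η))) :=
      (hsm θ).continuous_iteratedFDeriv (by exact_mod_cast le_top)
    refine Continuous.integrable_of_hasCompactSupport (by fun_prop) ?_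
    refine HasCompactSupport.intro hB fun η hη => ?_
    rw [hder0 n θ η hη]; simp
  choose D hD0 hD using hbd
  have hpow : ∀ n : ℕ, ∃ C : ℝ, 0 ≤ C ∧ ∀ θ ∈ K, ∀ y,
      ‖y‖ ^ n * ‖𝓕 (fun η => F (θ, η)) y‖ ≤ C := by
    intro n
    refine ⟨2 ^ n * ∑ m ∈ Finset.range (n + 1), ∫ v, B.indicator (fun _ => D m) v,
      ?_, fun θ hθ y => ?_⟩
    · refine mul_nonneg (by positivity) (Finset.sum_nonneg fun m _ => integral_nonneg fun v => ?_)
      exact Set.indicator_nonneg (fun _ _ => hD0 m) v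
    · have h := Real.pow_mul_norm_iteratedFDeriv_fourier_le (K := ⊤) (N := ⊤) (hsm θ)
        (fun k n _ _ => hint θ k n) (k := 0) (n := n) le_top le_top y
      simp only [norm_iteratedFDeriv_zero, pow_zero, one_mul, Nat.cast_zero, mul_zero,
        zero_add] at h
      refine h.trans ?_
      rw [Finset.sum_product]
      simp only [Finset.range_one, Finset.sum_singleton, pow_zero, one_mul]
      refine mul_le_mul_of_nonneg_left (Finset.sum_le_sum fun m _ => ?_) (by positivity)
      refine integral_mono (by simpa using hint θ 0 m) ?_ (fun v => hD m θ hθ v)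
      exact (integrable_indicator_iff hB.measurableSet).2
        (integrableOn_const hB.measure_lt_top.ne)
  obtain ⟨C₀, h0, hC₀⟩ := hpow 0
  obtain ⟨C₁, h1, hC₁⟩ := hpow N
  refine ⟨2 ^ N * (C₀ + C₁), by positivity, fun θ hθ y => ?_⟩
  have hy : (1 + ‖y‖) ^ N ≤ 2 ^ N * (1 + ‖y‖ ^ N) := by
    calc (1 + ‖y‖) ^ N ≤ 2 ^ (N - 1) * (1 ^ N + ‖y‖ ^ N) :=
          add_pow_le (by norm_num) (norm_nonneg _) N
      _ ≤ _ := by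
        rw [one_pow]
        gcongr
        · norm_num
        · omega
  have e0 := hC₀ θ hθ y
  have e1 := hC₁ θ hθ y
  rw [pow_zero, one_mul] at e0
  calc _ ≤ ‖𝓕 (fun η => F (θ, η)) y‖ * (2 ^ N * (1 + ‖y‖ ^ N)) := by gcongr
    _ = 2 ^ N * (‖𝓕 (fun η => F (θ, η)) y‖ + ‖y‖ ^ N * ‖𝓕 (fun η => F (θ, η)) y‖) := by ring
    _ ≤ _ := by gcongr

/-! ### Anisotropic shears of `ℝ³` and left translations -/

theorem Continuous.vec3 {X : Type*} [TopologicalSpace X] {f g h : X → ℝ} (hf : Continuous f)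
    (hg : Continuous g) (hh : Continuous h) :
    Continuous fun x => (!₂[f x, g x, h x] : HeisSpace) := by
  refine (PiLp.continuous_toLp 2 (fun _ : Fin 3 => ℝ)).comp (continuous_pi fun i => ?_)
  fin_cases i <;> simpa

theorem Filter.Tendsto.vec3 {X : Type*} {l : Filter X} {f g h : X → ℝ} {a b c : ℝ}
    (hf : l.Tendsto f (nhds a)) (hg : l.Tendsto g (nhds b)) (hh : l.Tendsto h (nhds c)) :
    l.Tendsto (fun x => (!₂[f x, g x, h x] : HeisSpace)) (nhds !₂[a, b, c]) := by
  refine ((PiLp.continuous_toLp 2 (fun _ : Fin 3 => ℝ)).tendsto _).comp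
    (tendsto_pi_nhds.2 fun i => ?_)
  fin_cases i <;> simpa

theorem abs_coord_le (x : HeisSpace) (i : Fin 3) : |x i| ≤ ‖x‖ := by
  simpa using PiLp.norm_apply_le x i

/-- The linear map `x ↦ R (e x₁, e x₂, x₃ + u x₁ + v x₂)`. -/
def heisShear (R e u v : ℝ) : HeisSpace →ₗ[ℝ] HeisSpace where
  toFun x := !₂[R * e * x 0, R * e * x 1, R * (x 2 + u * x 0 + v * x 1)]
  map_add' x y := by ext i; fin_cases i <;> simp <;> ring
  map_smul' k x := by ext i; fin_cases i <;> simp <;> ring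

/-- The inverse of `heisShear R e u v`. -/
noncomputable def heisShearInv (R e u v : ℝ) (w : HeisSpace) : HeisSpace :=
  !₂[w 0 / (R * e), w 1 / (R * e), w 2 / R - u * (w 0 / (R * e)) - v * (w 1 / (R * e))]

theorem heisShear_apply (R e u v : ℝ) (x : HeisSpace) :
    heisShear R e u v x = !₂[R * e * x 0, R * e * x 1, R * (x 2 + u * x 0 + v * x 1)] := rfl

theorem heisShear_heisShearInv {R e : ℝ} (hR : R ≠ 0) (he : e ≠ 0) (u v : ℝ) (w : HeisSpace) :
    heisShear R e u v (heisShearInv R e u v w) = w := by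
  ext i; fin_cases i <;> simp [heisShear_apply, heisShearInv] <;> field_simp <;> ring

theorem heisShearInv_heisShear {R e : ℝ} (hR : R ≠ 0) (he : e ≠ 0) (u v : ℝ) (x : HeisSpace) :
    heisShearInv R e u v (heisShear R e u v x) = x := by
  ext i; fin_cases i <;> simp [heisShear_apply, heisShearInv] <;> field_simp <;> ring

theorem det_heisShear (R e u v : ℝ) : LinearMap.det (heisShear R e u v) = e ^ 2 * R ^ 3 := by
  rw [← LinearMap.det_toMatrix (EuclideanSpace.basisFun (Fin 3) ℝ).toBasis, Matrix.det_fin_three]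
  simp [LinearMap.toMatrix_apply, heisShear_apply]
  ring

theorem continuous_heisShear (R e u v : ℝ) : Continuous (heisShear R e u v) :=
  LinearMap.continuous_of_finiteDimensional _

theorem continuous_heisShearInv (R e u v : ℝ) : Continuous (heisShearInv R e u v) :=
  Continuous.vec3 (by fun_prop) (by fun_prop) (by fun_prop)

theorem map_heisShear_volume {R e : ℝ} (hR : 0 < R) (he : 0 < e) (u v : ℝ) :
    Measure.map (heisShear R e u v) volume
      = ENNReal.ofReal (e ^ 2 * R ^ 3)⁻¹ • (volume : Measure HeisSpace) := by
  have hd : LinearMap.det (heisShear R e u v) ≠ 0 := by rw [det_heisShear]; positivity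
  rw [Measure.map_linearMap_addHaar_eq_smul_addHaar _ hd, det_heisShear,
    abs_of_pos (by positivity)]

theorem measurableEmbedding_heisShear {R e : ℝ} (hR : R ≠ 0) (he : e ≠ 0) (u v : ℝ) :
    MeasurableEmbedding (heisShear R e u v) :=
  (Homeomorph.mk ⟨heisShear R e u v, heisShearInv R e u v, heisShearInv_heisShear hR he u v,
    heisShear_heisShearInv hR he u v⟩ (continuous_heisShear R e u v)
    (continuous_heisShearInv R e u v)).measurableEmbedding

theorem integral_comp_heisShear {R e : ℝ} (hR : 0 < R) (he : 0 < e) (u v : ℝ)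
    (G : HeisSpace → ℂ) (x₀ : HeisSpace) :
    ∫ x, G (heisShear R e u v (x - x₀)) = ((e ^ 2 * R ^ 3)⁻¹ : ℝ) * ∫ w, G w := by
  rw [integral_sub_right_eq_self (fun x => G (heisShear R e u v x)) x₀,
    ← (measurableEmbedding_heisShear hR.ne' he.ne' u v).integral_map, map_heisShear_volume hR he,
    integral_smul_measure, ENNReal.toReal_ofReal (by positivity)]
  simp

theorem lintegral_comp_heisShear {R e : ℝ} (hR : 0 < R) (he : 0 < e) (u v : ℝ)
    (G : HeisSpace → ℝ≥0∞) (x₀ : HeisSpace) :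
    ∫⁻ x, G (heisShear R e u v (x - x₀)) = ENNReal.ofReal (e ^ 2 * R ^ 3)⁻¹ * ∫⁻ w, G w := by
  rw [lintegral_sub_right_eq_self (fun x => G (heisShear R e u v x)) x₀,
    ← (measurableEmbedding_heisShear hR.ne' he.ne' u v).lintegral_map, map_heisShear_volume hR he,
    lintegral_smul_measure]
  simp

theorem heisMul_eq_heisShear (x w : HeisSpace) :
    heisMul x w = heisShear 1 1 (-(x 1) / 2) (x 0 / 2) (w - heisInv x) := by
  ext i; fin_cases i <;> simp [heisShear_apply, heisMul, heisInv] <;> ring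

theorem heisInv_heisMul_cancel_left (x y : HeisSpace) : heisMul (heisInv x) (heisMul x y) = y := by
  ext i; fin_cases i <;> simp [heisMul, heisInv] <;> ring

theorem heisMul_heisInv_cancel_left (x y : HeisSpace) : heisMul x (heisMul (heisInv x) y) = y := by
  ext i; fin_cases i <;> simp [heisMul, heisInv] <;> ring

theorem continuous_heisMul : Continuous fun p : HeisSpace × HeisSpace => heisMul p.1 p.2 :=
  Continuous.vec3 (by fun_prop) (by fun_prop) (by fun_prop)

theorem integral_heisMul_left (G : HeisSpace → ℂ) (y : HeisSpace) :
    ∫ x, G (heisMul y x) = ∫ x, G x := by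
  simp_rw [heisMul_eq_heisShear]
  rw [integral_comp_heisShear one_pos one_pos]
  simp

theorem lintegral_heisMul_left (G : HeisSpace → ℝ≥0∞) (y : HeisSpace) :
    ∫⁻ x, G (heisMul y x) = ∫⁻ x, G x := by
  simp_rw [heisMul_eq_heisShear]
  rw [lintegral_comp_heisShear one_pos one_pos]
  simp

/-! ### Shears on the frequency side and the Bessel potential -/

/-- The transpose of `heisShear R e u v`. -/
def heisShearAdj (R e u v : ℝ) : HeisSpace →ₗ[ℝ] HeisSpace where
  toFun η := !₂[R * (e * η 0 + u * η 2), R * (e * η 1 + v * η 2), R * η 2]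
  map_add' x y := by ext i; fin_cases i <;> simp <;> ring
  map_smul' k x := by ext i; fin_cases i <;> simp <;> ring

/-- The inverse of `heisShearAdj R e u v`. -/
noncomputable def heisShearAdjInv (R e u v : ℝ) : HeisSpace →ₗ[ℝ] HeisSpace where
  toFun ξ := !₂[(ξ 0 - u * ξ 2) / (R * e), (ξ 1 - v * ξ 2) / (R * e), ξ 2 / R]
  map_add' x y := by ext i; fin_cases i <;> simp <;> ring
  map_smul' k x := by ext i; fin_cases i <;> simp <;> ring

theorem heisShearAdj_apply (R e u v : ℝ) (η : HeisSpace) : heisShearAdj R e u v η =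
    !₂[R * (e * η 0 + u * η 2), R * (e * η 1 + v * η 2), R * η 2] := rfl

theorem heisShearAdjInv_apply (R e u v : ℝ) (ξ : HeisSpace) : heisShearAdjInv R e u v ξ =
    !₂[(ξ 0 - u * ξ 2) / (R * e), (ξ 1 - v * ξ 2) / (R * e), ξ 2 / R] := rfl

theorem heisShearAdj_heisShearAdjInv {R e : ℝ} (hR : R ≠ 0) (he : e ≠ 0) (u v : ℝ)
    (ξ : HeisSpace) : heisShearAdj R e u v (heisShearAdjInv R e u v ξ) = ξ := by
  ext i; fin_cases i <;> simp [heisShearAdj_apply, heisShearAdjInv_apply] <;> field_simp <;> ring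

theorem heisShearAdjInv_heisShearAdj {R e : ℝ} (hR : R ≠ 0) (he : e ≠ 0) (u v : ℝ)
    (η : HeisSpace) : heisShearAdjInv R e u v (heisShearAdj R e u v η) = η := by
  ext i; fin_cases i <;> simp [heisShearAdj_apply, heisShearAdjInv_apply] <;> field_simp <;> ring

theorem det_heisShearAdj (R e u v : ℝ) :
    LinearMap.det (heisShearAdj R e u v) = e ^ 2 * R ^ 3 := by
  rw [← LinearMap.det_toMatrix (EuclideanSpace.basisFun (Fin 3) ℝ).toBasis, Matrix.det_fin_three]
  simp [LinearMap.toMatrix_apply, heisShearAdj_apply]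
  ring

theorem inner_heisShearAdj (R e u v : ℝ) (η x : HeisSpace) :
    inner ℝ (heisShearAdj R e u v η) x = inner ℝ η (heisShear R e u v x) := by
  simp [PiLp.inner_apply, Fin.sum_univ_three, heisShear_apply, heisShearAdj_apply]
  ring

/-- `heisShearAdj R e u v` as a homeomorphism. -/
noncomputable def heisShearAdjHomeo {R e : ℝ} (hR : R ≠ 0) (he : e ≠ 0) (u v : ℝ) :
    HeisSpace ≃ₜ HeisSpace :=
  ⟨⟨heisShearAdj R e u v, heisShearAdjInv R e u v, heisShearAdjInv_heisShearAdj hR he u v,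
    heisShearAdj_heisShearAdjInv hR he u v⟩, LinearMap.continuous_of_finiteDimensional _,
    LinearMap.continuous_of_finiteDimensional _⟩

theorem integral_comp_heisShearAdj {R e : ℝ} (hR : 0 < R) (he : 0 < e) (u v : ℝ)
    (G : HeisSpace → ℂ) :
    ∫ η, G (heisShearAdj R e u v η) = ((e ^ 2 * R ^ 3)⁻¹ : ℝ) * ∫ ξ, G ξ := by
  have hd : LinearMap.det (heisShearAdj R e u v) ≠ 0 := by rw [det_heisShearAdj]; positivity
  have hm := Measure.map_linearMap_addHaar_eq_smul_addHaar (volume : Measure HeisSpace) hd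
  rw [det_heisShearAdj, abs_of_pos (by positivity)] at hm
  have he := (heisShearAdjHomeo hR.ne' he.ne' u v).measurableEmbedding
  have : MeasurableEmbedding (heisShearAdj R e u v) := he
  rw [← this.integral_map, hm, integral_smul_measure, ENNReal.toReal_ofReal (by positivity)]
  simp

/-- The modulated dilate whose Fourier transform is `𝓕 σ (heisShear R e u v (· - x₀))`. -/
noncomputable def dilatedSymbol (R e u v : ℝ) (x₀ : HeisSpace) (σ : HeisSpace → ℂ)
    (ξ : HeisSpace) : ℂ :=
  ((e ^ 2 * R ^ 3)⁻¹ : ℝ) * Complex.exp ((2 * Real.pi * inner ℝ ξ x₀ : ℝ) * Complex.I) *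
    σ (heisShearAdjInv R e u v ξ)

theorem contDiff_dilatedSymbol (R e u v : ℝ) (x₀ : HeisSpace) {σ : HeisSpace → ℂ}
    (hσ : ContDiff ℝ ∞ σ) : ContDiff ℝ ∞ (dilatedSymbol R e u v x₀ σ) := by
  have h1 : ContDiff ℝ ∞ (fun ξ => σ (heisShearAdjInv R e u v ξ)) :=
    hσ.comp (LinearMap.toContinuousLinearMap (heisShearAdjInv R e u v)).contDiff
  have h2 : ContDiff ℝ ∞ (fun ξ : HeisSpace => ((2 * Real.pi * inner ℝ ξ x₀ : ℝ) : ℂ)) :=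
    Complex.ofRealCLM.contDiff.comp
      (contDiff_const.mul (contDiff_id.inner ℝ contDiff_const))
  exact (contDiff_const.mul (Complex.contDiff_exp.comp (h2.mul contDiff_const))).mul h1

theorem hasCompactSupport_dilatedSymbol {R e : ℝ} (hR : R ≠ 0) (he : e ≠ 0) (u v : ℝ)
    (x₀ : HeisSpace) {σ : HeisSpace → ℂ} (hσ : HasCompactSupport σ) :
    HasCompactSupport (dilatedSymbol R e u v x₀ σ) :=
  (hσ.comp_homeomorph (heisShearAdjHomeo hR he u v).symm).mul_left

theorem fourier_dilatedSymbol {R e : ℝ} (hR : 0 < R) (he : 0 < e) (u v : ℝ)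
    (x₀ : HeisSpace) (σ : HeisSpace → ℂ) (x : HeisSpace) :
    𝓕 (dilatedSymbol R e u v x₀ σ) x = 𝓕 σ (heisShear R e u v (x - x₀)) := by
  rw [Real.fourier_eq', Real.fourier_eq']
  have h := integral_comp_heisShearAdj hR he u v
    (fun ξ => Complex.exp ((-2 * Real.pi * inner ℝ ξ (x - x₀) : ℝ) * Complex.I) *
      σ (heisShearAdjInv R e u v ξ))
  simp only [heisShearAdjInv_heisShearAdj hR.ne' he.ne', inner_heisShearAdj] at h
  simp only [smul_eq_mul]
  rw [h, ← integral_const_mul]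
  congr 1
  ext ξ
  have hexp : Complex.exp ((-2 * Real.pi * inner ℝ ξ x : ℝ) * Complex.I) *
      Complex.exp ((2 * Real.pi * inner ℝ ξ x₀ : ℝ) * Complex.I) =
      Complex.exp ((-2 * Real.pi * inner ℝ ξ (x - x₀) : ℝ) * Complex.I) := by
    rw [← Complex.exp_add, inner_sub_right]
    congr 1
    push_cast
    ring
  rw [dilatedSymbol]
  linear_combination (((e ^ 2 * R ^ 3)⁻¹ : ℝ) * σ (heisShearAdjInv R e u v ξ)) * hexp

/-- The symbol of the rescaled Bessel potential of order `-s`, cut off by `χ`. -/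
noncomputable def besselSymbol (s : ℝ) (χ : HeisSpace → ℂ) (p : (ℝ × ℝ × ℝ × ℝ) × HeisSpace) : ℂ :=
  χ p.2 * (((p.1.1 ^ 2 + (p.1.2.1 * p.2 0 + p.1.2.2.1 * p.2 2) ^ 2 +
    (p.1.2.1 * p.2 1 + p.1.2.2.2 * p.2 2) ^ 2 + (p.2 2) ^ 2) ^ (-s / 2) : ℝ) : ℂ)

/-- On the support of `χ` the base of the power is at least `η₃² ≥ 1/16`, whatever the parameters.
So the symbol stays smooth at the degenerate values `R⁻¹ = 0`, `e = 0`, and the scales in `(0, 1]`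
can be completed to a compact parameter set. -/
theorem contDiff_besselSymbol (s : ℝ) {χ : HeisSpace → ℂ} (hχ : ContDiff ℝ ∞ χ)
    (hχ0 : ∀ η : HeisSpace, η 2 < 1 / 4 → χ η = 0) : ContDiff ℝ ∞ (besselSymbol s χ) := by
  rw [contDiff_iff_contDiffAt]
  rintro ⟨θ, η⟩
  by_cases h : η 2 < 1 / 4
  · have ho : IsOpen {p : (ℝ × ℝ × ℝ × ℝ) × HeisSpace | p.2 2 < 1 / 4} :=
      isOpen_lt (by fun_prop) (by fun_prop)
    have : besselSymbol s χ =ᶠ[nhds (θ, η)] fun _ => 0 := by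
      filter_upwards [ho.mem_nhds h] with p hp
      simp [besselSymbol, hχ0 p.2 hp]
    exact contDiffAt_const.congr_of_eventuallyEq this
  · have hpos : θ.1 ^ 2 + (θ.2.1 * η 0 + θ.2.2.1 * η 2) ^ 2 +
        (θ.2.1 * η 1 + θ.2.2.2 * η 2) ^ 2 + (η 2) ^ 2 ≠ 0 := by
      have : 0 < η 2 := by linarith
      positivity
    refine ContDiffAt.mul (hχ.comp contDiff_snd).contDiffAt ?_
    refine Complex.ofRealCLM.contDiff.contDiffAt.comp _ ?_
    refine ContDiffAt.rpow_const_of_ne ?_ hpos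
    fun_prop

theorem hasCompactSupport_besselSymbol (s : ℝ) {χ : HeisSpace → ℂ} (hχ : HasCompactSupport χ)
    (θ : ℝ × ℝ × ℝ × ℝ) : HasCompactSupport (fun η => besselSymbol s χ (θ, η)) :=
  hχ.mul_right

/-- With `ξ` the image of `η` under the transposed shear, `1 + |ξ|²` equals `R²` times the base in
`besselSymbol`; the powers `R ^ s` and `R ^ (-s)` cancel. -/
theorem besselWeight_mul_dilatedSymbol {R e : ℝ} (hR : 0 < R) (he : 0 < e) (u v s : ℝ)
    (x₀ : HeisSpace) {χ : HeisSpace → ℂ} (hχ0 : ∀ η : HeisSpace, η 2 < 1 / 4 → χ η = 0)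
    (ξ : HeisSpace) :
    (((1 + ‖ξ‖ ^ 2) ^ (s / 2) : ℝ) : ℂ) *
        (((R ^ (-s) : ℝ) : ℂ) *
          dilatedSymbol R e u v x₀ (fun η => besselSymbol s χ ((R⁻¹, e, u, v), η)) ξ)
      = dilatedSymbol R e u v x₀ χ ξ := by
  set η := heisShearAdjInv R e u v ξ with hη
  have hξ : ξ = heisShearAdj R e u v η := (heisShearAdj_heisShearAdjInv hR.ne' he.ne' u v ξ).symm
  by_cases h : η 2 < 1 / 4
  · simp [dilatedSymbol, besselSymbol, ← hη, hχ0 η h]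
  set q : ℝ := R⁻¹ ^ 2 + (e * η 0 + u * η 2) ^ 2 + (e * η 1 + v * η 2) ^ 2 + (η 2) ^ 2 with hq
  have hqpos : 0 < q := by positivity
  have h1 : 1 + ‖ξ‖ ^ 2 = R ^ 2 * q := by
    rw [EuclideanSpace.norm_sq_eq, Fin.sum_univ_three, hξ, heisShearAdj_apply, hq]
    simp only [Real.norm_eq_abs, sq_abs, Matrix.cons_val]
    field_simp
    ring
  have h2 : (1 + ‖ξ‖ ^ 2) ^ (s / 2) * (R ^ (-s) * q ^ (-s / 2)) = 1 := by
    rw [h1, Real.mul_rpow (by positivity) hqpos.le, ← Real.rpow_natCast, ← Real.rpow_mul hR.le,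
      mul_mul_mul_comm, ← Real.rpow_add hR, ← Real.rpow_add hqpos]
    have e1 : ((2 : ℕ) : ℝ) * (s / 2) + -s = 0 := by push_cast; ring
    have e2 : s / 2 + -s / 2 = 0 := by ring
    rw [e1, e2]; simp
  have h3 := congrArg (fun r : ℝ => (r : ℂ)) h2
  simp only [Complex.ofReal_mul, Complex.ofReal_one] at h3
  simp only [dilatedSymbol, besselSymbol, ← hη, ← hq]
  linear_combination (((e ^ 2 * R ^ 3)⁻¹ : ℝ) *
    Complex.exp ((2 * Real.pi * inner ℝ ξ x₀ : ℝ) * Complex.I) * χ η) * h3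

/-- Pairing an identity `⟨D⟩ˢ u = g` with an affine image of a function whose Fourier transform
is a test function. -/
theorem integral_mul_fourier_heisShear_eq {s : ℝ} {p : ℝ≥0∞} [Fact (1 ≤ p)]
    {U g : Lp ℂ p (volume : Measure HeisSpace)}
    (hU : TemperedDistribution.besselPotential HeisSpace ℂ s (Lp.toTemperedDistribution U) =
      Lp.toTemperedDistribution g)
    {χ : HeisSpace → ℂ} (hχ : ContDiff ℝ ∞ χ) (hχc : HasCompactSupport χ)
    (hχ0 : ∀ η : HeisSpace, η 2 < 1 / 4 → χ η = 0)
    {R e : ℝ} (hR : 0 < R) (he : 0 < e) (u v : ℝ) (x₀ : HeisSpace) :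
    ∫ x, U x * 𝓕 χ (heisShear R e u v (x - x₀)) =
      ((R ^ (-s) : ℝ) : ℂ) * ∫ x, g x * 𝓕 (fun η => besselSymbol s χ ((R⁻¹, e, u, v), η))
        (heisShear R e u v (x - x₀)) := by
  set σ := fun η => besselSymbol s χ ((R⁻¹, e, u, v), η) with hσ
  have hσs : ContDiff ℝ ∞ σ := (contDiff_besselSymbol s hχ hχ0).comp (by fun_prop)
  have hσc : HasCompactSupport σ := hasCompactSupport_besselSymbol s hχc _
  set m := (hasCompactSupport_dilatedSymbol hR.ne' he.ne' u v x₀ hσc).toSchwartzMap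
    (contDiff_dilatedSymbol R e u v x₀ hσs) with hm
  set m₀ := (hasCompactSupport_dilatedSymbol hR.ne' he.ne' u v x₀ hχc).toSchwartzMap
    (contDiff_dilatedSymbol R e u v x₀ hχ) with hm₀
  have hw : (fun x : HeisSpace => (((1 + ‖x‖ ^ 2) ^ (s / 2) : ℝ) : ℂ)).HasTemperateGrowth := by
    fun_prop
  have hmul : SchwartzMap.smulLeftCLM ℂ (fun x : HeisSpace => (((1 + ‖x‖ ^ 2) ^ (s / 2) : ℝ) : ℂ))
      (((R ^ (-s) : ℝ) : ℂ) • m) = m₀ := by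
    ext ξ
    rw [SchwartzMap.smulLeftCLM_apply_apply hw]
    exact besselWeight_mul_dilatedSymbol hR he u v s x₀ hχ0 ξ
  -- The multiplier acts on the inverse Fourier transform of the test function, so testing on `𝓕 (R
  -- ^ (-s) • m)` leaves `𝓕 m₀` on the side of `U`.
  have h := DFunLike.congr_fun hU (𝓕 (((R ^ (-s) : ℝ) : ℂ) • m))
  rw [TemperedDistribution.besselPotential,
    TemperedDistribution.fourierMultiplierCLM_apply_apply,
    FourierTransform.fourierInv_fourier_eq, hmul, Lp.toTemperedDistribution_apply,
    Lp.toTemperedDistribution_apply, FourierTransform.fourier_smul] at h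
  have e0 : ∀ x, (𝓕 m₀ : SchwartzMap HeisSpace ℂ) x = 𝓕 χ (heisShear R e u v (x - x₀)) := fun x => by
    rw [SchwartzMap.fourier_coe]; exact fourier_dilatedSymbol hR he u v x₀ χ x
  have e1 : ∀ x, (𝓕 m : SchwartzMap HeisSpace ℂ) x = 𝓕 σ (heisShear R e u v (x - x₀)) := fun x => by
    rw [SchwartzMap.fourier_coe]; exact fourier_dilatedSymbol hR he u v x₀ σ x
  simp only [e0, e1, _root_.smul_apply, smul_eq_mul] at h
  simp_rw [mul_comm (U _), mul_comm (g _)]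
  rw [h, ← integral_const_mul]
  simp_rw [mul_assoc]

/-! ### The test function -/

/-- A test function with frequencies away from `η₃ = 0` whose Fourier transform is nonnegative on
the plane `y₃ = 0` and nonzero at the origin. -/
theorem exists_testFunction : ∃ χ : HeisSpace → ℂ, ContDiff ℝ ∞ χ ∧ HasCompactSupport χ ∧
    (∀ η : HeisSpace, η 2 < 1 / 4 → χ η = 0) ∧
    (∀ y : HeisSpace, y 2 = 0 → ∃ r : ℝ, 0 ≤ r ∧ 𝓕 χ y = r) ∧ 𝓕 χ 0 ≠ 0 := by
  -- A bump of outer radius `1/4` about height `1/2` lives above height `1/4`. Its self-convolution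
  -- lives even higher, and its Fourier transform is the square of that of the bump.
  set c : HeisSpace := !₂[0, 0, 1 / 2] with hc
  let f : ContDiffBump c := ⟨1 / 8, 1 / 4, by norm_num, by norm_num⟩
  set F : HeisSpace → ℂ := fun x => (f x : ℂ) with hF
  have hFs : ContDiff ℝ ∞ F := Complex.ofRealCLM.contDiff.comp f.contDiff
  have hFc : HasCompactSupport F := f.hasCompactSupport.comp_left Complex.ofReal_zero
  have hFi : Integrable F := hFs.continuous.integrable_of_hasCompactSupport hFc
  have hconv : ∀ y, 𝓕 (MeasureTheory.convolution F F (ContinuousLinearMap.mul ℂ ℂ) volume) y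
      = 𝓕 F y * 𝓕 F y := Real.fourier_mul_convolution_eq hFi hFi
  refine ⟨MeasureTheory.convolution F F (ContinuousLinearMap.mul ℂ ℂ) volume, ?_, ?_, ?_, ?_, ?_⟩
  · have h : ContDiff ℝ ∞ (convolution F F (ContinuousLinearMap.mul ℝ ℂ) volume) :=
      hFc.contDiff_convolution_right (n := ⊤) (ContinuousLinearMap.mul ℝ ℂ)
        hFi.locallyIntegrable hFs
    exact h
  · exact hFc.convolution _ hFc
  · intro η hη
    by_contra h
    have := MeasureTheory.support_convolution_subset (ContinuousLinearMap.mul ℂ ℂ)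
      (μ := volume) (f := F) (g := F) h
    obtain ⟨x, hx, y, hy, rfl⟩ := this
    have key : ∀ z ∈ Function.support F, 1 / 4 < z 2 := by
      intro z hz
      have hz' : z ∈ Function.support f := by
        intro h0; apply hz; simp [hF, h0]
      rw [f.support_eq, Metric.mem_ball, dist_eq_norm] at hz'
      have h1 := (abs_coord_le (z - c) 2).trans_lt hz'
      have h2 : (z - c) 2 = z 2 - 1 / 2 := by simp [hc]
      rw [h2, abs_lt] at h1
      have : f.rOut = 1 / 4 := rfl
      linarith [h1.1]
    have h1 := key x hx
    have h2 := key y hy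
    simp at hη
    linarith
  · intro y hy
    rw [hconv]
    -- The bump is symmetric about `c`, and `c` is orthogonal to `y` when `y₃ = 0`. The reflection
    -- `x ↦ 2c - x` therefore conjugates the phase, so `𝓕 F y` is real and its square is
    -- nonnegative.
    have hreal : (starRingEnd ℂ) (𝓕 F y) = 𝓕 F y := by
      rw [Real.fourier_eq', ← integral_conj]
      rw [← integral_sub_left_eq_self _ volume (c + c)]
      congr 1
      ext x
      have hsymm : f (c + c - x) = f x := by
        simpa [sub_eq_add_neg, add_assoc, add_comm] using f.sub (x - c)
      have hin : inner ℝ (c + c - x) y = - inner ℝ x y := by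
        rw [inner_sub_left]
        have : inner ℝ (c + c) y = (0:ℝ) := by
          simp [PiLp.inner_apply, Fin.sum_univ_three, hc, hy]
        rw [this, zero_sub]
      simp only [hF, smul_eq_mul, map_mul, Complex.conj_ofReal, hsymm, hin, ← Complex.exp_conj,
        Complex.conj_I]
      congr 2
      push_cast
      ring
    obtain ⟨r, hr⟩ := Complex.conj_eq_iff_real.1 hreal
    exact ⟨r * r, mul_self_nonneg r, by rw [hr]; push_cast; ring⟩
  · rw [hconv]
    have h0 : 𝓕 F 0 = ((∫ x, f x : ℝ) : ℂ) := by
      rw [Real.fourier_eq', ← integral_complex_ofReal]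
      simp [hF]
    have := f.integral_pos (μ := volume)
    rw [h0]
    exact mul_ne_zero (by exact_mod_cast this.ne') (by exact_mod_cast this.ne')

/-! ### Hölder and interpolation between supremum and mass -/

/-- Hölder, combined with `W ^ q ≤ A ^ (q - 1) W` for the conjugate exponent `q`, since `1 - 1/q =
1/p`. The endpoints are separate because the conjugate pair used has both exponents finite. -/
theorem lintegral_enorm_mul_le_of_le {X : Type*} [MeasurableSpace X] {μ : Measure X} {p : ℝ≥0∞}
    (hp : 1 ≤ p) {g : X → ℂ} (hg : AEStronglyMeasurable g μ) {W : X → ℝ≥0∞} (hW : AEMeasurable W μ)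
    {A B : ℝ≥0∞} (hA : ∀ x, W x ≤ A) (hB : ∫⁻ x, W x ∂μ ≤ B) :
    ∫⁻ x, ‖g x‖ₑ * W x ∂μ
      ≤ eLpNorm g p μ * (A ^ (1 / p).toReal * B ^ (1 - (1 / p).toReal)) := by
  rcases eq_or_ne p ∞ with rfl | hpt
  · simp only [ENNReal.div_top, ENNReal.toReal_zero, ENNReal.rpow_zero, sub_zero,
      ENNReal.rpow_one, one_mul, eLpNorm_exponent_top]
    calc ∫⁻ x, ‖g x‖ₑ * W x ∂μ ≤ ∫⁻ x, eLpNormEssSup g μ * W x ∂μ := by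
          refine lintegral_mono_ae ?_
          filter_upwards [enorm_ae_le_eLpNormEssSup g μ] with x hx
          gcongr
      _ = eLpNormEssSup g μ * ∫⁻ x, W x ∂μ := lintegral_const_mul'' _ hW
      _ ≤ _ := by gcongr
  rcases eq_or_ne p 1 with rfl | hp1
  · simp only [div_one, ENNReal.toReal_one, sub_self, ENNReal.rpow_zero, ENNReal.rpow_one,
      mul_one, eLpNorm_one_eq_lintegral_enorm]
    rw [← lintegral_mul_const'' _ hg.enorm]
    exact lintegral_mono fun x => by gcongr; exact hA x
  set r := p.toReal with hr
  have hp0 : p ≠ 0 := (zero_lt_one.trans_le hp).ne'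
  have hr1 : 1 < r := by
    rw [hr, ← ENNReal.toReal_one]
    exact (ENNReal.toReal_lt_toReal ENNReal.one_ne_top hpt).2 (lt_of_le_of_ne hp hp1.symm)
  have hθ : (1 / p).toReal = 1 / r := by simp [hr]
  have hc := Real.HolderConjugate.conjExponent hr1
  set q := r.conjExponent
  have hq1 : 1 < q := hc.symm.lt
  refine (ENNReal.lintegral_mul_le_Lp_mul_Lq μ hc hg.enorm hW).trans ?_
  rw [eLpNorm_eq_lintegral_rpow_enorm_toReal hp0 hpt, hθ]
  gcongr
  have h1 : ∫⁻ x, W x ^ q ∂μ ≤ A ^ (q - 1) * B := by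
    calc ∫⁻ x, W x ^ q ∂μ ≤ ∫⁻ x, A ^ (q - 1) * W x ∂μ := by
          refine lintegral_mono fun x => ?_
          calc W x ^ q = W x ^ (q - 1) * W x ^ (1 : ℝ) := by
                rw [← ENNReal.rpow_add_of_nonneg _ _ (by linarith) zero_le_one]; simp
            _ ≤ _ := by
                rw [ENNReal.rpow_one]
                gcongr
                exact hA x
      _ = A ^ (q - 1) * ∫⁻ x, W x ∂μ := lintegral_const_mul'' _ hW
      _ ≤ _ := by gcongr
  have hq : 1 / q = 1 - 1 / r := by
    have := hc.inv_add_inv_eq_one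
    rw [one_div, one_div]; linarith
  have hq2 : (q - 1) * (1 / q) = 1 / r := by
    have hq0 : q ≠ 0 := by linarith
    have : (q - 1) * (1 / q) = 1 - 1 / q := by field_simp
    rw [this, hq]; ring
  calc (∫⁻ x, W x ^ q ∂μ) ^ (1 / q) ≤ (A ^ (q - 1) * B) ^ (1 / q) := by gcongr
    _ = _ := by
      rw [ENNReal.mul_rpow_of_nonneg _ _ (by positivity), ← ENNReal.rpow_mul, hq2, hq]

theorem eLpNorm_le_of_le_of_lintegral_le {X : Type*} [MeasurableSpace X] {μ : Measure X}
    {p : ℝ≥0∞} (hp : 1 ≤ p) {f : X → ℂ} (hf : AEStronglyMeasurable f μ) {A B : ℝ≥0∞}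
    (hA : ∀ x, ‖f x‖ₑ ≤ A) (hB : ∫⁻ x, ‖f x‖ₑ ∂μ ≤ B) :
    eLpNorm f p μ ≤ A ^ (1 - (1 / p).toReal) * B ^ (1 / p).toReal := by
  rcases eq_or_ne p ∞ with rfl | hpt
  · simp only [ENNReal.div_top, ENNReal.toReal_zero, ENNReal.rpow_zero, sub_zero,
      ENNReal.rpow_one, mul_one, eLpNorm_exponent_top]
    exact essSup_le_of_ae_le _ (Filter.Eventually.of_forall hA)
  have hp0 : p ≠ 0 := (zero_lt_one.trans_le hp).ne'
  set r := p.toReal with hr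
  have hr1 : 1 ≤ r := by
    rw [hr, ← ENNReal.toReal_one]
    exact (ENNReal.toReal_le_toReal ENNReal.one_ne_top hpt).2 hp
  have hθ : (1 / p).toReal = 1 / r := by simp [hr]
  rw [eLpNorm_eq_lintegral_rpow_enorm_toReal hp0 hpt, hθ, ← hr]
  have h1 : ∫⁻ x, ‖f x‖ₑ ^ r ∂μ ≤ A ^ (r - 1) * B := by
    calc ∫⁻ x, ‖f x‖ₑ ^ r ∂μ ≤ ∫⁻ x, A ^ (r - 1) * ‖f x‖ₑ ∂μ := by
          refine lintegral_mono fun x => ?_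
          calc ‖f x‖ₑ ^ r = ‖f x‖ₑ ^ (r - 1) * ‖f x‖ₑ ^ (1 : ℝ) := by
                rw [← ENNReal.rpow_add_of_nonneg _ _ (by linarith) zero_le_one]; simp
            _ ≤ _ := by
                rw [ENNReal.rpow_one]
                gcongr
                exact hA x
      _ = A ^ (r - 1) * ∫⁻ x, ‖f x‖ₑ ∂μ := lintegral_const_mul'' _ hf.enorm
      _ ≤ _ := by gcongr
  have hq2 : (r - 1) * (1 / r) = 1 - 1 / r := by
    have hq0 : r ≠ 0 := by linarith
    field_simp
  calc (∫⁻ x, ‖f x‖ₑ ^ r ∂μ) ^ (1 / r) ≤ (A ^ (r - 1) * B) ^ (1 / r) := by gcongr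
    _ = _ := by
      rw [ENNReal.mul_rpow_of_nonneg _ _ (by positivity), ← ENNReal.rpow_mul, hq2]

theorem lintegral_inv_one_add_norm_pow_four_lt_top {V : Type*} [NormedAddCommGroup V]
    [NormedSpace ℝ V] [FiniteDimensional ℝ V] [MeasurableSpace V] [BorelSpace V] (μ : Measure V)
    [μ.IsAddHaarMeasure] (hV : Module.finrank ℝ V ≤ 3) :
    ∫⁻ y : V, ENNReal.ofReal ((1 + ‖y‖) ^ 4)⁻¹ ∂μ < ⊤ := by
  have h : (Module.finrank ℝ V : ℝ) < 4 := by
    have : (Module.finrank ℝ V : ℝ) ≤ 3 := by exact_mod_cast hV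
    linarith
  refine (finite_integral_one_add_norm (μ := μ) h).trans_eq' ?_
  refine lintegral_congr fun y => ?_
  rw [Real.rpow_neg (by positivity)]
  norm_num

/-! ### Localized pairings: domination and nonzero limit -/

/-- The first coordinate alone controls the time variable: `|r| ≤ ‖y‖ + 1`. This gives integrability
in `r` without any information on the other coordinates, hence uniformly over all the transition
maps. -/
theorem norm_le_div_one_add_sq_of_decay {ψ : HeisSpace → ℂ} {C : ℝ}
    (hψC : ∀ y, ‖ψ y‖ * (1 + ‖y‖) ^ 4 ≤ C) {y w : HeisSpace} {r : ℝ} (hy : y 0 = w 0 - r)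
    (hw : ‖w‖ ≤ 1) : ‖ψ y‖ ≤ 4 * C * (1 + r ^ 2)⁻¹ := by
  have h1 : |r| ≤ ‖y‖ + 1 := by
    have e1 := abs_coord_le y 0
    have e2 := (abs_coord_le w 0).trans hw
    rw [hy] at e1
    calc |r| = |w 0 - (w 0 - r)| := by ring_nf
      _ ≤ |w 0| + |w 0 - r| := abs_sub _ _
      _ ≤ _ := by linarith
  have h2 : 1 + r ^ 2 ≤ 4 * (1 + ‖y‖) ^ 4 := by
    have h0 := norm_nonneg y
    have h3 : (1 + ‖y‖) ^ 2 ≤ (1 + ‖y‖) ^ 4 := pow_le_pow_right₀ (by linarith) (by norm_num)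
    have h4 : r ^ 2 ≤ (‖y‖ + 1) ^ 2 := sq_le_sq' (by linarith [neg_abs_le r]) (by linarith [le_abs_self r])
    nlinarith
  rw [← div_eq_mul_inv, le_div_iff₀ (by positivity)]
  calc ‖ψ y‖ * (1 + r ^ 2) ≤ ‖ψ y‖ * (4 * (1 + ‖y‖) ^ 4) := by gcongr
    _ = 4 * (‖ψ y‖ * (1 + ‖y‖) ^ 4) := by ring
    _ ≤ _ := by gcongr; exact hψC y

/-- The dominating function for the localized pairings. -/
theorem integrable_pairing_bound (α β K : ℝ) :
    Integrable (fun q : (ℝ × HeisSpace) × ℝ =>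
      (K * (Metric.closedBall (0 : HeisSpace) 1).indicator (fun _ => (1 : ℝ)) q.1.2)
        * (1 + q.2 ^ 2)⁻¹)
      (((volume.restrict (Set.Icc α β)).prod volume).prod volume) := by
  have h1 : Integrable ((Metric.closedBall (0 : HeisSpace) 1).indicator (fun _ => (1 : ℝ))) :=
    (integrable_indicator_iff measurableSet_closedBall).2
      (integrableOn_const (isCompact_closedBall _ _).measure_lt_top.ne)
  have h2 : Integrable (fun _ : ℝ => K) (volume.restrict (Set.Icc α β)) :=
    integrable_const _
  exact (h2.mul_prod h1).mul_prod integrable_inv_one_add_sq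

section Pairing

variable {α β : ℝ} {a b : ℝ → ℂ} {φ ψ : HeisSpace → ℂ} {C : ℝ}

/-- The bound is uniform in the scale `ε` and in the map `Z`. -/
theorem exists_pairing_dominated (ha : Continuous a) (hb : Continuous b)
    (hbc : HasCompactSupport b) (hφ1 : ∀ w, ‖φ w‖ ≤ 1) (hφ0 : ∀ w, φ w ≠ 0 → ‖w‖ ≤ 1)
    (hψC : ∀ y, ‖ψ y‖ * (1 + ‖y‖) ^ 4 ≤ C) :
    ∃ K : ℝ, ∀ (ε : ℝ) (Z : (ℝ × HeisSpace) × ℝ → HeisSpace),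
      (∀ q, Z q 0 = q.1.2 0 - q.2) →
      ∀ᵐ q ∂((volume.restrict (Set.Icc α β)).prod (volume : Measure HeisSpace)).prod volume,
        ‖a q.1.1 * b (q.1.1 + ε * q.2) * φ q.1.2 * ψ (Z q)‖ ≤
          (K * (Metric.closedBall (0 : HeisSpace) 1).indicator (fun _ => (1 : ℝ)) q.1.2)
            * (1 + q.2 ^ 2)⁻¹ := by
  obtain ⟨A, hA⟩ := (isCompact_Icc (a := α) (b := β)).exists_bound_of_continuousOn ha.continuousOn
  obtain ⟨B, hB⟩ := hb.bounded_above_of_compact_support hbc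
  have hC0 : 0 ≤ C := (by positivity : (0:ℝ) ≤ ‖ψ 0‖ * (1 + ‖(0 : HeisSpace)‖) ^ 4).trans (hψC 0)
  have hB0 : 0 ≤ B := (norm_nonneg _).trans (hB 0)
  refine ⟨max A 0 * B * (4 * C), fun ε Z hZ => ?_⟩
  -- The amplitude `a` is bounded only on `[α, β]`, so the domination holds almost everywhere for
  -- the restricted measure.
  have hae : ∀ᵐ q ∂((volume.restrict (Set.Icc α β)).prod (volume : Measure HeisSpace)).prod
      (volume : Measure ℝ), q.1.1 ∈ Set.Icc α β := by
    have h1 : ∀ᵐ t ∂(volume.restrict (Set.Icc α β)), t ∈ Set.Icc α β :=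
      ae_restrict_mem measurableSet_Icc
    exact Measure.quasiMeasurePreserving_fst.ae (Measure.quasiMeasurePreserving_fst.ae h1)
  filter_upwards [hae] with q hq
  by_cases hw : φ q.1.2 = 0
  · simp only [hw, mul_zero, zero_mul, norm_zero]
    have : 0 ≤ (Metric.closedBall (0 : HeisSpace) 1).indicator (fun _ => (1 : ℝ)) q.1.2 :=
      Set.indicator_nonneg (fun _ _ => zero_le_one) _
    positivity
  · have hw1 := hφ0 _ hw
    rw [Set.indicator_of_mem (by simpa using hw1), mul_one]
    simp only [norm_mul]
    calc ‖a q.1.1‖ * ‖b (q.1.1 + ε * q.2)‖ * ‖φ q.1.2‖ * ‖ψ (Z q)‖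
        ≤ max A 0 * B * 1 * (4 * C * (1 + q.2 ^ 2)⁻¹) := by
          gcongr
          · exact (hA _ hq).trans (le_max_left _ _)
          · exact hB _
          · exact hφ1 _
          · exact norm_le_div_one_add_sq_of_decay hψC (hZ q) hw1
      _ = _ := by ring

theorem integrable_pairing (ha : Continuous a) (hb : Continuous b)
    (hbc : HasCompactSupport b) (hφ : Continuous φ) (hφ1 : ∀ w, ‖φ w‖ ≤ 1)
    (hφ0 : ∀ w, φ w ≠ 0 → ‖w‖ ≤ 1) (hψ : Continuous ψ)
    (hψC : ∀ y, ‖ψ y‖ * (1 + ‖y‖) ^ 4 ≤ C) (ε : ℝ) {Z : (ℝ × HeisSpace) × ℝ → HeisSpace}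
    (hZ : Continuous Z) (hZ0 : ∀ q, Z q 0 = q.1.2 0 - q.2) :
    Integrable (fun q : (ℝ × HeisSpace) × ℝ =>
      a q.1.1 * b (q.1.1 + ε * q.2) * φ q.1.2 * ψ (Z q))
      (((volume.restrict (Set.Icc α β)).prod volume).prod volume) := by
  obtain ⟨K, hK⟩ := exists_pairing_dominated (α := α) (β := β) ha hb hbc hφ1 hφ0 hψC
  have hc : Continuous (fun q : (ℝ × HeisSpace) × ℝ =>
      a q.1.1 * b (q.1.1 + ε * q.2) * φ q.1.2 * ψ (Z q)) := by fun_prop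
  exact (integrable_pairing_bound α β K).mono' hc.aestronglyMeasurable (hK ε Z hZ0)

/-- The localized pairings converge to a nonzero limit. -/
theorem exists_pairing_lower_bound {t₀ : ℝ} (ht₀ : t₀ ∈ Set.Ioo α β) (ha : Continuous a)
    (ha₀ : a t₀ ≠ 0) (hψ : Continuous ψ) (hψC : ∀ y, ‖ψ y‖ * (1 + ‖y‖) ^ 4 ≤ C)
    {Z₀ : (ℝ × HeisSpace) × ℝ → HeisSpace} (hZ₀ : Continuous Z₀)
    (hZ₀0 : ∀ q, Z₀ q 0 = q.1.2 0 - q.2)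
    (hpos : ∀ r, ∃ x : ℝ, 0 ≤ x ∧ ψ (Z₀ ((t₀, 0), r)) = x) (hne : ψ (Z₀ ((t₀, 0), 0)) ≠ 0) :
    ∃ (b : ℝ → ℂ) (φ : HeisSpace → ℂ), Continuous b ∧ HasCompactSupport b ∧ Continuous φ ∧
      (∀ w, ‖φ w‖ ≤ 1) ∧ (∀ w, φ w ≠ 0 → ‖w‖ ≤ 1) ∧
      ∀ Z : ℝ → (ℝ × HeisSpace) × ℝ → HeisSpace, (∀ ε > 0, Continuous (Z ε)) →
        (∀ ε > 0, ∀ q, Z ε q 0 = q.1.2 0 - q.2) →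
        (∀ t ∈ Set.Ioo α β, ∀ w r, Filter.Tendsto (fun ε => Z ε ((t, w), r))
          (nhdsWithin 0 (Set.Ioi 0)) (nhds (Z₀ ((t, w), r)))) →
        ∃ c > 0, ∀ᶠ ε in nhdsWithin 0 (Set.Ioi 0),
          c ≤ ‖∫ q, a q.1.1 * b (q.1.1 + ε * q.2) * φ q.1.2 * ψ (Z ε q)
            ∂(((volume.restrict (Set.Icc α β)).prod volume).prod volume)‖ := by
  have hC0 : 0 ≤ C := (by positivity : (0:ℝ) ≤ ‖ψ 0‖ * (1 + ‖(0 : HeisSpace)‖) ^ 4).trans (hψC 0)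
  -- The limiting pairing after integration in the rescaled time difference. It is continuous at
  -- `(t₀, 0)` and positive there by `hpos` and `hne`.
  set P : ℝ × HeisSpace → ℂ := fun z => ∫ r, ψ (Z₀ (z, r)) with hP
  have hbd : Integrable (fun r : ℝ => 4 * C * (1 + r ^ 2)⁻¹) :=
    integrable_inv_one_add_sq.const_mul _
  have hPc : ContinuousAt P (t₀, 0) := by
    refine continuousAt_of_dominated (bound := fun r => 4 * C * (1 + r ^ 2)⁻¹) ?_ ?_ hbd ?_
    · exact Filter.Eventually.of_forall fun z =>
        (show Continuous fun r => ψ (Z₀ (z, r)) by fun_prop).aestronglyMeasurable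
    · have : ∀ᶠ z : ℝ × HeisSpace in nhds (t₀, 0), ‖z.2‖ < 1 :=
        (isOpen_lt (by fun_prop) continuous_const).mem_nhds (by simp)
      filter_upwards [this] with z hz
      exact Filter.Eventually.of_forall fun r =>
        norm_le_div_one_add_sq_of_decay hψC (hZ₀0 (z, r)) hz.le
    · exact Filter.Eventually.of_forall fun r =>
        (show Continuous fun z => ψ (Z₀ (z, r)) by fun_prop).continuousAt
  have hP0 : ∃ x : ℝ, 0 < x ∧ P (t₀, 0) = x := by
    choose x hx0 hx using hpos
    have hxc : Continuous x := by
      have : x = fun r => (ψ (Z₀ ((t₀, 0), r))).re := by ext r; rw [hx]; simp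
      rw [this]; fun_prop
    have hxi : Integrable x := by
      refine hbd.mono' hxc.aestronglyMeasurable (Filter.Eventually.of_forall fun r => ?_)
      have := norm_le_div_one_add_sq_of_decay hψC (hZ₀0 ((t₀, 0), r)) (by simp)
      rwa [hx, Complex.norm_real] at this
    refine ⟨∫ r, x r, ?_, ?_⟩
    · rw [integral_pos_iff_support_of_nonneg hx0 hxi]
      refine hxc.isOpen_support.measure_pos volume ⟨0, fun h => hne ?_⟩
      rw [hx, h, Complex.ofReal_zero]
    · simp only [hP, hx]
      exact integral_complex_ofReal
  obtain ⟨x₀, hx₀, hPx⟩ := hP0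
  -- The factor `conj (a t₀)` will be built into `b`: it turns `a t` near `t₀` into a number with
  -- positive real part, so nothing cancels when `b` and `φ` are concentrated near `t₀` and `0`.
  set H : ℝ × HeisSpace → ℝ := fun z => ((starRingEnd ℂ) (a t₀) * a z.1 * P z).re with hH
  have hHc : ContinuousAt H (t₀, 0) := by
    refine Complex.continuous_re.continuousAt.comp (ContinuousAt.mul ?_ hPc)
    exact (show Continuous fun z : ℝ × HeisSpace => (starRingEnd ℂ) (a t₀) * a z.1
      by fun_prop).continuousAt
  have hH0 : 0 < H (t₀, 0) := by
    simp only [hH, hPx]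
    rw [mul_comm ((starRingEnd ℂ) _), Complex.mul_conj, ← Complex.ofReal_mul, Complex.ofReal_re]
    exact mul_pos (Complex.normSq_pos.2 ha₀) hx₀
  obtain ⟨η', hη'0, hη'⟩ := Metric.eventually_nhds_iff.1 (hHc.eventually (lt_mem_nhds hH0))
  -- The cap at 1 serves twice: the cone `max 0 (η - ‖w‖)` is at most 1 and is supported in the unit
  -- ball.
  set η := min η' 1 with hη
  have hη0 : 0 < η := lt_min hη'0 one_pos
  have hηH : ∀ t w, |t - t₀| < η → ‖w‖ < η → 0 < H (t, w) := by
    intro t w ht hw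
    refine hη' ?_
    rw [Prod.dist_eq, max_lt_iff, Real.dist_eq, dist_zero_right]
    exact ⟨ht.trans_le (min_le_left _ _), hw.trans_le (min_le_left _ _)⟩
  set b₀ : ℝ → ℝ := fun t => max 0 (η - |t - t₀|) with hb₀
  set φ₀ : HeisSpace → ℝ := fun w => max 0 (η - ‖w‖) with hφ₀
  have hb₀c : Continuous b₀ := by fun_prop
  have hφ₀c : Continuous φ₀ := by fun_prop
  have hb₀s : HasCompactSupport b₀ := by
    refine HasCompactSupport.intro (isCompact_closedBall t₀ η) fun t ht => ?_
    rw [Metric.mem_closedBall, Real.dist_eq, not_le] at ht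
    exact max_eq_left (by linarith)
  have hφw : ∀ w, φ₀ w ≠ 0 → ‖w‖ < η := by
    intro w hw
    by_contra h
    exact hw (max_eq_left (by linarith))
  have hbt : ∀ t, b₀ t ≠ 0 → |t - t₀| < η := by
    intro w hw
    by_contra h
    exact hw (max_eq_left (by linarith))
  have hb : Continuous (fun t => (starRingEnd ℂ) (a t₀) * (b₀ t : ℂ)) := by fun_prop
  have hbs : HasCompactSupport (fun t => (starRingEnd ℂ) (a t₀) * (b₀ t : ℂ)) :=
    (hb₀s.comp_left (g := fun x : ℝ => (x : ℂ)) Complex.ofReal_zero).mul_left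
  have hφ : Continuous (fun w => (φ₀ w : ℂ)) := by fun_prop
  have hφ1 : ∀ w, ‖(φ₀ w : ℂ)‖ ≤ 1 := by
    intro w
    rw [Complex.norm_real, Real.norm_eq_abs, abs_of_nonneg (le_max_left _ _)]
    refine max_le zero_le_one ?_
    have := norm_nonneg w
    have := min_le_right η' 1
    linarith
  have hφ0 : ∀ w, (φ₀ w : ℂ) ≠ 0 → ‖w‖ ≤ 1 := by
    intro w hw
    exact (hφw w (by simpa using hw)).le.trans (min_le_right _ _)
  refine ⟨_, _, hb, hbs, hφ, hφ1, hφ0, fun Z hZc hZ0 hZl => ?_⟩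
  set μ := ((volume.restrict (Set.Icc α β)).prod (volume : Measure HeisSpace)).prod
    (volume : Measure ℝ) with hμ
  set L : ℂ := ∫ q, a q.1.1 * ((starRingEnd ℂ) (a t₀) * (b₀ (q.1.1 + 0 * q.2) : ℂ)) * φ₀ q.1.2 *
    ψ (Z₀ q) ∂μ with hL
  have hLi : Integrable (fun q : (ℝ × HeisSpace) × ℝ => a q.1.1 *
      ((starRingEnd ℂ) (a t₀) * (b₀ (q.1.1 + 0 * q.2) : ℂ)) * φ₀ q.1.2 * ψ (Z₀ q)) μ :=
    integrable_pairing ha hb hbs hφ hφ1 hφ0 hψ hψC 0 hZ₀ hZ₀0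
  have hinner : ∀ z : ℝ × HeisSpace, ∫ r, a z.1 *
      ((starRingEnd ℂ) (a t₀) * (b₀ (z.1 + 0 * r) : ℂ)) * φ₀ z.2 * ψ (Z₀ (z, r)) =
      ((b₀ z.1 * φ₀ z.2 : ℝ) : ℂ) * ((starRingEnd ℂ) (a t₀) * a z.1 * P z) := by
    intro z
    simp only [zero_mul, add_zero]
    rw [integral_const_mul]
    push_cast
    ring
  have hLeq : L = ∫ z, ((b₀ z.1 * φ₀ z.2 : ℝ) : ℂ) * ((starRingEnd ℂ) (a t₀) * a z.1 * P z)
      ∂((volume.restrict (Set.Icc α β)).prod volume) := by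
    rw [hL, hμ, integral_prod _ hLi]
    exact integral_congr_ae (Filter.Eventually.of_forall hinner)
  have hLi' : Integrable (fun z => ((b₀ z.1 * φ₀ z.2 : ℝ) : ℂ) *
      ((starRingEnd ℂ) (a t₀) * a z.1 * P z))
      ((volume.restrict (Set.Icc α β)).prod volume) :=
    hLi.integral_prod_left.congr (Filter.Eventually.of_forall hinner)
  have hre : ∀ z : ℝ × HeisSpace, (((b₀ z.1 * φ₀ z.2 : ℝ) : ℂ) *
      ((starRingEnd ℂ) (a t₀) * a z.1 * P z)).re = b₀ z.1 * φ₀ z.2 * H z := by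
    intro z
    rw [Complex.re_ofReal_mul]
  have hLre : 0 < L.re := by
    have h1 : L.re = ∫ z, b₀ z.1 * φ₀ z.2 * H z
        ∂((volume.restrict (Set.Icc α β)).prod volume) := by
      rw [hLeq]
      have h := integral_re hLi'
      simp only [RCLike.re_eq_complex_re, hre] at h
      exact h.symm
    have hi : Integrable (fun z : ℝ × HeisSpace => b₀ z.1 * φ₀ z.2 * H z)
        ((volume.restrict (Set.Icc α β)).prod volume) := by
      have h := hLi'.re
      simpa only [RCLike.re_eq_complex_re, hre] using h
    have hnn : 0 ≤ fun z : ℝ × HeisSpace => b₀ z.1 * φ₀ z.2 * H z := by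
      intro z
      by_cases hb0 : b₀ z.1 = 0
      · simp [hb0]
      by_cases hf0 : φ₀ z.2 = 0
      · simp [hf0]
      have h1 : 0 ≤ b₀ z.1 := le_max_left _ _
      have h2 : 0 ≤ φ₀ z.2 := le_max_left _ _
      exact mul_nonneg (mul_nonneg h1 h2) (hηH _ _ (hbt _ hb0) (hφw _ hf0)).le
    rw [h1, integral_pos_iff_support_of_nonneg hnn hi]
    have hsub : (Metric.ball t₀ η ∩ Set.Ioo α β) ×ˢ Metric.ball (0 : HeisSpace) η ⊆
        Function.support fun z : ℝ × HeisSpace => b₀ z.1 * φ₀ z.2 * H z := by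
      rintro ⟨t, w⟩ ⟨⟨ht, -⟩, hw⟩
      rw [Metric.mem_ball, Real.dist_eq] at ht
      rw [Metric.mem_ball, dist_zero_right] at hw
      have h1 : 0 < b₀ t := lt_max_of_lt_right (by linarith)
      have h2 : 0 < φ₀ w := lt_max_of_lt_right (by linarith)
      exact (mul_pos (mul_pos h1 h2) (hηH t w ht hw)).ne'
    refine lt_of_lt_of_le ?_ (measure_mono hsub)
    rw [Measure.prod_prod]
    refine ENNReal.mul_pos ?_ (Metric.measure_ball_pos volume _ hη0).ne'
    rw [Measure.restrict_apply (Metric.isOpen_ball.inter isOpen_Ioo).measurableSet,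
      Set.inter_assoc, Set.inter_eq_left.2 Set.Ioo_subset_Icc_self]
    exact ((Metric.isOpen_ball.inter isOpen_Ioo).measure_pos volume
      ⟨t₀, Metric.mem_ball_self hη0, ht₀⟩).ne'
  have hLne : L ≠ 0 := fun h => by simp [h] at hLre
  have hlim : Filter.Tendsto (fun ε => ∫ q, a q.1.1 *
      ((starRingEnd ℂ) (a t₀) * (b₀ (q.1.1 + ε * q.2) : ℂ)) * φ₀ q.1.2 * ψ (Z ε q) ∂μ)
      (nhdsWithin 0 (Set.Ioi 0)) (nhds L) := by
    obtain ⟨K, hK⟩ := exists_pairing_dominated (α := α) (β := β) ha hb hbs hφ1 hφ0 hψC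
    refine tendsto_integral_filter_of_dominated_convergence _ ?_ ?_
      (integrable_pairing_bound α β K) ?_
    · filter_upwards [self_mem_nhdsWithin] with ε hε
      exact (integrable_pairing ha hb hbs hφ hφ1 hφ0 hψ hψC ε (hZc ε hε)
        (hZ0 ε hε)).aestronglyMeasurable
    · filter_upwards [self_mem_nhdsWithin] with ε hε
      exact hK ε (Z ε) (hZ0 ε hε)
    -- Convergence of `Z ε` is assumed only at interior times; the two endpoints are a null set.
    · have hae : ∀ᵐ q ∂μ, q.1.1 ∈ Set.Ioo α β := by
        have h1 : ∀ᵐ t ∂(volume.restrict (Set.Icc α β)), t ∈ Set.Ioo α β := by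
          rw [← Measure.restrict_congr_set Ioo_ae_eq_Icc]
          exact ae_restrict_mem measurableSet_Ioo
        exact Measure.quasiMeasurePreserving_fst.ae (Measure.quasiMeasurePreserving_fst.ae h1)
      filter_upwards [hae] with q hq
      have h1 : Filter.Tendsto (fun ε : ℝ => (b₀ (q.1.1 + ε * q.2) : ℂ))
          (nhdsWithin 0 (Set.Ioi 0)) (nhds (b₀ (q.1.1 + 0 * q.2) : ℂ)) :=
        ((show Continuous fun ε : ℝ => (b₀ (q.1.1 + ε * q.2) : ℂ) by fun_prop).tendsto 0).mono_left
          nhdsWithin_le_nhds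
      exact ((tendsto_const_nhds.mul (tendsto_const_nhds.mul h1)).mul tendsto_const_nhds).mul
        ((hψ.tendsto _).comp (hZl q.1.1 hq q.1.2 q.2))
  have hLpos : 0 < ‖L‖ := norm_pos_iff.2 hLne
  refine ⟨‖L‖ / 2, by positivity, ?_⟩
  filter_upwards [hlim.norm.eventually (lt_mem_nhds (half_lt_self hLpos))] with ε hε
  exact hε.le

end Pairing

/-! ### The determinant condition and one-variable calculus -/

/-- The determinant condition says that, up to an affine change of `γ₃`, the curve is horizontal
for the Heisenberg contact structure. -/
theorem exists_deriv_eq_of_det {α β : ℝ} {γ₂ γ₃ : ℝ → ℝ} (hγ₂ : ContDiff ℝ ∞ γ₂)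
    (hγ₃ : ContDiff ℝ ∞ γ₃) (hcurv : ∀ t ∈ Set.Icc α β, iteratedDeriv 2 γ₂ t ≠ 0)
    (hdet : ∀ t ∈ Set.Icc α β,
      Matrix.det !![iteratedDeriv 2 γ₂ t, iteratedDeriv 2 γ₃ t;
                    iteratedDeriv 3 γ₂ t, iteratedDeriv 3 γ₃ t]
        = 1 / 2 * (iteratedDeriv 2 γ₂ t) ^ 2) :
    ∃ c d : ℝ, ∀ t ∈ Set.Icc α β,
      deriv γ₃ t = d + c * deriv γ₂ t + 1 / 2 * (t * deriv γ₂ t - γ₂ t) := by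
  have hd : ∀ {f : ℝ → ℝ}, ContDiff ℝ ∞ f → ∀ (n : ℕ) (t : ℝ),
      HasDerivAt (iteratedDeriv n f) (iteratedDeriv (n + 1) f t) t := by
    intro f hf n t
    rw [iteratedDeriv_succ]
    exact ((hf.differentiable_iteratedDeriv n (by exact_mod_cast ENat.natCast_lt_top n)) t).hasDerivAt
  have hdw := fun t => hd hγ₂ 1 t
  simp only [iteratedDeriv_one] at hdw
  have hdw3 := fun t => hd hγ₃ 1 t
  simp only [iteratedDeriv_one] at hdw3
  have hd0 := fun t => hd hγ₂ 0 t
  simp only [iteratedDeriv_zero, zero_add, iteratedDeriv_one] at hd0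
  -- The quotient rule gives `(γ₃''/γ₂'')' = det / (γ₂'')² = 1/2`, so `γ₃'' = (c + t/2) γ₂''`.
  have h1 : ∀ t ∈ Set.Icc α β, HasDerivAt
      (fun t => iteratedDeriv 2 γ₃ t / iteratedDeriv 2 γ₂ t - t / 2) 0 t := by
    intro t ht
    have h := ((hd hγ₃ 2 t).div (hd hγ₂ 2 t) (hcurv t ht)).sub ((hasDerivAt_id t).div_const 2)
    refine h.congr_deriv ?_
    have hD := hdet t ht
    rw [Matrix.det_fin_two_of] at hD
    have hne := hcurv t ht
    field_simp
    linarith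
  have h2 := constant_of_has_deriv_right_zero (a := α) (b := β)
    (fun t ht => (h1 t ht).continuousAt.continuousWithinAt)
    (fun t ht => (h1 t (Set.Ico_subset_Icc_self ht)).hasDerivWithinAt)
  set c := iteratedDeriv 2 γ₃ α / iteratedDeriv 2 γ₂ α - α / 2 with hc
  -- Second integration, using that `(t γ₂' - γ₂)/2` is a primitive of `t γ₂''/2`.
  have h3 : ∀ t ∈ Set.Icc α β, HasDerivAt
      (fun t => deriv γ₃ t - c * deriv γ₂ t - 1 / 2 * (t * deriv γ₂ t - γ₂ t)) 0 t := by
    intro t ht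
    have h := ((hdw3 t).sub ((hdw t).const_mul c)).sub
      ((((hasDerivAt_id t).mul (hdw t)).sub (hd0 t)).const_mul (1 / 2))
    refine h.congr_deriv ?_
    have h4 := h2 t ht
    have hne := hcurv t ht
    have h5 : iteratedDeriv 2 γ₃ t = (c + t / 2) * iteratedDeriv 2 γ₂ t := by
      rw [← h4]; field_simp; ring
    simp only [Nat.reduceAdd, h5, id]
    ring
  have h6 := constant_of_has_deriv_right_zero (a := α) (b := β)
    (fun t ht => (h3 t ht).continuousAt.continuousWithinAt)
    (fun t ht => (h3 t (Set.Ico_subset_Icc_self ht)).hasDerivWithinAt)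
  exact ⟨c, deriv γ₃ α - c * deriv γ₂ α - 1 / 2 * (α * deriv γ₂ α - γ₂ α),
    fun t ht => by linarith [h6 t ht]⟩

theorem HasDerivAt.tendsto_sub_div {f : ℝ → ℝ} {f' t : ℝ} (hf : HasDerivAt f f' t) (r : ℝ) :
    Filter.Tendsto (fun ε => (f t - f (t + ε * r)) / ε) (nhdsWithin 0 (Set.Ioi 0))
      (nhds (-(r * f'))) := by
  have h1 : HasDerivAt (fun ε : ℝ => t + ε * r) r 0 := by
    simpa using ((hasDerivAt_id (0 : ℝ)).mul_const r).const_add t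
  have h2 : HasDerivAt (fun ε : ℝ => f (t + ε * r)) (f' * r) 0 := by
    refine HasDerivAt.comp (h₂ := f) (0 : ℝ) ?_ h1
    simpa using hf
  have h3 := (h2.tendsto_slope.mono_left (nhdsWithin_mono 0
    (fun x (hx : 0 < x) => hx.ne' : Set.Ioi (0 : ℝ) ⊆ {0}ᶜ))).neg
  rw [mul_comm] at h3
  refine h3.congr fun ε => ?_
  simp [slope_def_field]
  ring

/-- Integrating a first order `o`-estimate of the derivative. -/
theorem isLittleO_sq_of_hasDerivAt {G G' : ℝ → ℝ} {t : ℝ}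
    (hG : ∀ᶠ τ in nhds t, HasDerivAt G (G' τ) τ) (hGt : G t = 0)
    (hG' : G' =o[nhds t] fun τ => τ - t) : G =o[nhds t] fun τ => (τ - t) ^ 2 := by
  rw [Asymptotics.isLittleO_iff] at hG' ⊢
  intro k hk
  obtain ⟨ρ, hρ, h⟩ := Metric.eventually_nhds_iff_ball.1 (hG.and (hG' hk))
  filter_upwards [Metric.ball_mem_nhds t hρ] with τ hτ
  -- The mean value inequality on the ball of radius `|τ - t|`, where the derivative is at most `k
  -- |τ - t|`, yields `k (τ - t)²`.
  have hsub : Metric.closedBall t ‖τ - t‖ ⊆ Metric.ball t ρ :=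
    Metric.closedBall_subset_ball (by simpa [dist_eq_norm] using hτ)
  have hmv := (convex_closedBall t ‖τ - t‖).norm_image_sub_le_of_norm_hasDerivWithin_le
    (f := G) (f' := G') (C := k * ‖τ - t‖)
    (fun x hx => (h x (hsub hx)).1.hasDerivWithinAt)
    (fun x hx => (h x (hsub hx)).2.trans (by
      gcongr
      simpa [dist_eq_norm] using hx))
    (Metric.mem_closedBall_self (norm_nonneg _))
    (show τ ∈ Metric.closedBall t ‖τ - t‖ by simp [dist_eq_norm])
  rw [hGt, sub_zero] at hmv
  rw [norm_pow]
  calc ‖G τ‖ ≤ _ := hmv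
    _ = _ := by ring

theorem integrable_of_compact_support_ae {X : Type*} [TopologicalSpace X] [MeasurableSpace X]
    [OpensMeasurableSpace X] [T2Space X] {μ : Measure X}
    [IsFiniteMeasureOnCompacts μ] {F : X → ℂ} (hF : Continuous F) {K : Set X}
    (hK : IsCompact K) (h : ∀ᵐ x ∂μ, x ∉ K → F x = 0) : Integrable F μ :=
  (hF.continuousOn.integrableOn_compact hK).integrable_of_ae_notMem_eq_zero h

theorem exponent_le_of_eventually_le {c D m κ : ℝ} (hc : 0 < c)
    (h : ∀ᶠ ε in nhdsWithin (0 : ℝ) (Set.Ioi 0), c * ε ^ m ≤ D * ε ^ κ) : κ ≤ m := by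
  by_contra! hlt
  have h1 : Filter.Tendsto (fun ε : ℝ => D * ε ^ (κ - m)) (nhdsWithin 0 (Set.Ioi 0)) (nhds 0) := by
    have := (Real.continuousAt_rpow_const 0 (κ - m) (Or.inr (by linarith))).tendsto.mono_left
      (nhdsWithin_le_nhds (s := Set.Ioi (0 : ℝ)))
    rw [Real.zero_rpow (by linarith)] at this
    simpa using this.const_mul D
  obtain ⟨ε, h2, h3, h4⟩ := (h.and ((h1.eventually (gt_mem_nhds hc)).and
    self_mem_nhdsWithin)).exists
  have hε : 0 < ε := h4
  have h5 : 0 < ε ^ m := Real.rpow_pos_of_pos hε m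
  rw [Real.rpow_sub hε, mul_div_assoc', div_lt_iff₀ h5] at h3
  linarith

theorem lintegral_comp_sub_div {F : ℝ → ℝ≥0∞} (hF : Measurable F) {ε : ℝ} (hε : 0 < ε) (x : ℝ) :
    ∫⁻ t, F ((x - t) / ε) = ENNReal.ofReal ε * ∫⁻ t, F t := by
  rw [lintegral_sub_left_eq_self (fun t => F (t / ε)) x]
  simp_rw [div_eq_inv_mul]
  rw [← lintegral_map (f := F) hF (measurable_const_mul ε⁻¹),
    Real.map_volume_mul_left (inv_ne_zero hε.ne'), lintegral_smul_measure, inv_inv, abs_of_pos hε]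
  rfl

/-! ### Pairings in the original time variables -/

section Pairing

variable {α β : ℝ} {a b : ℝ → ℂ} {φ ψ : HeisSpace → ℂ} {C : ℝ}

theorem ae_fst_mem_Icc (α β : ℝ) :
    ∀ᵐ z ∂((volume.restrict (Set.Icc α β)).prod (volume : Measure HeisSpace)),
      z.1 ∈ Set.Icc α β := by
  have h1 : ∀ᵐ t ∂(volume.restrict (Set.Icc α β)), t ∈ Set.Icc α β :=
    ae_restrict_mem measurableSet_Icc
  exact Measure.quasiMeasurePreserving_fst.ae h1

theorem integrable_pairing_unscaled (ha : Continuous a) (hb : Continuous b)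
    (hbc : HasCompactSupport b) (hφ : Continuous φ) (hφ0 : ∀ w, φ w ≠ 0 → ‖w‖ ≤ 1)
    (hψ : Continuous ψ) {Y : (ℝ × HeisSpace) × ℝ → HeisSpace} (hY : Continuous Y) :
    Integrable (fun p : (ℝ × HeisSpace) × ℝ => a p.1.1 * b p.2 * φ p.1.2 * ψ (Y p))
      (((volume.restrict (Set.Icc α β)).prod volume).prod volume) := by
  refine integrable_of_compact_support_ae (by fun_prop)
    (((isCompact_Icc (a := α) (b := β)).prod (isCompact_closedBall (0 : HeisSpace) 1)).prod hbc.isCompact) ?_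
  filter_upwards [Measure.quasiMeasurePreserving_fst.ae (ae_fst_mem_Icc α β)] with p hp hK
  by_contra h
  have h1 : b p.2 ≠ 0 := by intro h0; simp [h0] at h
  have h2 : φ p.1.2 ≠ 0 := by intro h0; simp [h0] at h
  exact hK ⟨⟨hp, by simpa using hφ0 _ h2⟩, subset_tsupport _ h1⟩

theorem integrable_pairing_slice (ha : Continuous a)
    (hφ : Continuous φ) (hφ0 : ∀ w, φ w ≠ 0 → ‖w‖ ≤ 1)
    (hψ : Continuous ψ) {Y : ℝ × HeisSpace → HeisSpace} (hY : Continuous Y) :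
    Integrable (fun z : ℝ × HeisSpace => a z.1 * φ z.2 * ψ (Y z))
      ((volume.restrict (Set.Icc α β)).prod volume) := by
  refine integrable_of_compact_support_ae (by fun_prop)
    ((isCompact_Icc (a := α) (b := β)).prod (isCompact_closedBall (0 : HeisSpace) 1)) ?_
  filter_upwards [ae_fst_mem_Icc α β] with z hz hK
  by_contra h
  have h2 : φ z.2 ≠ 0 := by intro h0; simp [h0] at h
  exact hK ⟨hz, by simpa using hφ0 _ h2⟩

/-- The substitution `t' = t + ε r`, whose Jacobian is the factor `ε`: the two times interact only
when they are about `ε` apart. -/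
theorem integral_pairing_unscaled (ha : Continuous a) (hb : Continuous b)
    (hbc : HasCompactSupport b) (hφ : Continuous φ) (hφ1 : ∀ w, ‖φ w‖ ≤ 1)
    (hφ0 : ∀ w, φ w ≠ 0 → ‖w‖ ≤ 1) (hψ : Continuous ψ)
    (hψC : ∀ y, ‖ψ y‖ * (1 + ‖y‖) ^ 4 ≤ C) {ε : ℝ} (hε : 0 < ε)
    {Y : (ℝ × HeisSpace) × ℝ → HeisSpace} (hY : Continuous Y)
    (hY0 : ∀ p, Y p 0 = p.1.2 0 + (p.1.1 - p.2) / ε) :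
    ∫ z, (∫ t', a z.1 * b t' * φ z.2 * ψ (Y (z, t'))) ∂((volume.restrict (Set.Icc α β)).prod volume)
      = ε * ∫ q, a q.1.1 * b (q.1.1 + ε * q.2) * φ q.1.2 * ψ (Y (q.1, q.1.1 + ε * q.2))
        ∂(((volume.restrict (Set.Icc α β)).prod volume).prod volume) := by
  have hi := integrable_pairing (α := α) (β := β) ha hb hbc hφ hφ1 hφ0 hψ hψC ε
    (Z := fun q => Y (q.1, q.1.1 + ε * q.2)) (by fun_prop) (fun q => by
      rw [hY0]
      field_simp
      ring)
  rw [integral_prod _ hi, ← integral_const_mul]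
  congr 1
  ext z
  set g : ℝ → ℂ := fun t' => a z.1 * b t' * φ z.2 * ψ (Y (z, t')) with hg
  change ∫ t', g t' = ε * ∫ r, g (z.1 + ε * r)
  rw [Measure.integral_comp_mul_left (fun r => g (z.1 + r)), integral_add_left_eq_self g z.1,
    abs_of_pos (inv_pos.2 hε), Complex.real_smul, ← mul_assoc, ← Complex.ofReal_mul,
    mul_inv_cancel₀ hε.ne']
  simp

end Pairing

/-! ### Horizontal example: pairing identities and limit -/

section HorizontalExample

variable {α β c d : ℝ} {γ₂ γ₃ : ℝ → ℝ} {a b : ℝ → ℂ} {φ ψ : HeisSpace → ℂ} {C : ℝ}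

/-- The parabolic rescaling adapted to the left translate by `γ(t)` of the contact plane. -/
noncomputable def curveShear (γ₂ : ℝ → ℝ) (c d ε t : ℝ) : HeisSpace →ₗ[ℝ] HeisSpace :=
  heisShear (ε ^ 2)⁻¹ ε (γ₂ t / 2 - d) (-(t / 2 + c))

/-- The transition map between the rescaled coordinates at `γ(t)` and at `γ(t')`. -/
noncomputable def curveTransition (γ₂ γ₃ : ℝ → ℝ) (c d ε : ℝ) (p : (ℝ × HeisSpace) × ℝ) :
    HeisSpace :=
  !₂[p.1.2 0 + (p.1.1 - p.2) / ε, p.1.2 1 + (γ₂ p.1.1 - γ₂ p.2) / ε,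
    p.1.2 2 + ((γ₂ p.2 - γ₂ p.1.1) / 2 * p.1.2 0 - (p.2 - p.1.1) / 2 * p.1.2 1) / ε +
      (γ₃ p.1.1 - γ₃ p.2 + (γ₂ p.2 / 2 - d) * (p.1.1 - p.2) -
        (p.2 / 2 + c) * (γ₂ p.1.1 - γ₂ p.2)) / ε ^ 2]

/-- Expresses the test-function coordinates at `γ(t')` through those of the bump at `γ(t)`, so that
after a change of variables the pairing depends only on `w` and the two times. -/
theorem curveShear_eq_curveTransition {ε : ℝ} (hε : 0 < ε) (t t' : ℝ) (x : HeisSpace) :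
    curveShear γ₂ c d ε t' (x - heisCurve γ₂ γ₃ t') =
      curveTransition γ₂ γ₃ c d ε
        ((t, curveShear γ₂ c d ε t (x - heisCurve γ₂ γ₃ t)), t') := by
  ext i
  fin_cases i <;> simp [curveShear, curveTransition, heisShear_apply, heisCurve] <;> field_simp <;>
    ring

theorem heisShear_heisMul_heisInv_heisCurve (ε t : ℝ) (x : HeisSpace) :
    heisShear (ε ^ 2)⁻¹ ε (-d) (-c) (heisMul (heisInv (heisCurve γ₂ γ₃ t)) x) =
      curveShear γ₂ c d ε t (x - heisCurve γ₂ γ₃ t) := by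
  ext i
  fin_cases i <;> simp [curveShear, heisShear_apply, heisCurve, heisMul, heisInv,
    -mul_eq_mul_left_iff] <;> ring

theorem continuous_curveTransition (hγ₂ : Continuous γ₂) (hγ₃ : Continuous γ₃) (ε : ℝ) :
    Continuous (curveTransition γ₂ γ₃ c d ε) :=
  Continuous.vec3 (by fun_prop) (by fun_prop) (by fun_prop)

theorem continuous_heisCurve (hγ₂ : Continuous γ₂) (hγ₃ : Continuous γ₃) :
    Continuous (heisCurve γ₂ γ₃) :=
  Continuous.vec3 (by fun_prop) (by fun_prop) (by fun_prop)

theorem Continuous.curveShear_sub {X : Type*} [TopologicalSpace X] {f : X → ℝ} {g : X → HeisSpace}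
    (hf : Continuous f) (hg : Continuous g) (hγ₂ : Continuous γ₂) (hγ₃ : Continuous γ₃) (ε : ℝ) :
    Continuous fun x => curveShear γ₂ c d ε (f x) (g x - heisCurve γ₂ γ₃ (f x)) := by
  have := continuous_heisCurve hγ₂ hγ₃
  exact Continuous.vec3 (by fun_prop) (by fun_prop) (by fun_prop)

theorem integrable_mul_curveShear (ha : Continuous a)
    (hγ₂ : Continuous γ₂) (hγ₃ : Continuous γ₃) (hφ : Continuous φ)
    (hφ0 : ∀ w, φ w ≠ 0 → ‖w‖ ≤ 1) (hψ : Continuous ψ) {ε : ℝ} (hε : 0 < ε) (t' : ℝ) :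
    Integrable (Function.uncurry fun (x : HeisSpace) (t : ℝ) =>
        a t * φ (curveShear γ₂ c d ε t (x - heisCurve γ₂ γ₃ t)) *
          ψ (curveShear γ₂ c d ε t' (x - heisCurve γ₂ γ₃ t')))
      ((volume : Measure HeisSpace).prod (volume.restrict (Set.Icc α β))) := by
  have hγ := continuous_heisCurve hγ₂ hγ₃
  have h1 : Continuous fun p : HeisSpace × ℝ =>
      curveShear γ₂ c d ε p.2 (p.1 - heisCurve γ₂ γ₃ p.2) :=
    Continuous.curveShear_sub continuous_snd continuous_fst hγ₂ hγ₃ ε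
  have h2 : Continuous fun p : HeisSpace × ℝ =>
      curveShear γ₂ c d ε t' (p.1 - heisCurve γ₂ γ₃ t') :=
    Continuous.curveShear_sub continuous_const continuous_fst hγ₂ hγ₃ ε
  -- Recovers `x` from `t` and its rescaled coordinates `w`, so the integrand vanishes off a compact
  -- image of `[α, β]` times the unit ball.
  have hinv : Continuous fun p : ℝ × HeisSpace => heisCurve γ₂ γ₃ p.1 +
      heisShearInv (ε ^ 2)⁻¹ ε (γ₂ p.1 / 2 - d) (-(p.1 / 2 + c)) p.2 :=
    (by fun_prop : Continuous fun p : ℝ × HeisSpace => heisCurve γ₂ γ₃ p.1).add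
      (Continuous.vec3 (by fun_prop) (by fun_prop) (by fun_prop))
  have hK := ((isCompact_Icc (a := α) (b := β)).prod
    (isCompact_closedBall (0 : HeisSpace) 1)).image hinv
  refine integrable_of_compact_support_ae
    (((ha.comp continuous_snd).mul (hφ.comp h1)).mul (hψ.comp h2))
    (hK.prod (isCompact_Icc (a := α) (b := β))) ?_
  have hae : ∀ᵐ t ∂(volume.restrict (Set.Icc α β)), t ∈ Set.Icc α β :=
    ae_restrict_mem measurableSet_Icc
  filter_upwards [Measure.quasiMeasurePreserving_snd.ae hae] with p hp hpK
  by_contra h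
  have h2 : φ (curveShear γ₂ c d ε p.2 (p.1 - heisCurve γ₂ γ₃ p.2)) ≠ 0 := by
    intro h0; apply h; simp [Function.uncurry, -map_sub, h0]
  refine hpK ⟨⟨(p.2, curveShear γ₂ c d ε p.2 (p.1 - heisCurve γ₂ γ₃ p.2)),
    ⟨hp, by simpa only [mem_closedBall_zero_iff] using hφ0 _ h2⟩, ?_⟩, hp⟩
  change heisCurve γ₂ γ₃ p.2 + heisShearInv (ε ^ 2)⁻¹ ε (γ₂ p.2 / 2 - d) (-(p.2 / 2 + c))
    (heisShear (ε ^ 2)⁻¹ ε (γ₂ p.2 / 2 - d) (-(p.2 / 2 + c)) (p.1 - heisCurve γ₂ γ₃ p.2)) = p.1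
  rw [heisShearInv_heisShear (by positivity) hε.ne']
  abel

theorem integral_heisAverage_mul_curveShear (ha : Continuous a)
    (hγ₂ : Continuous γ₂) (hγ₃ : Continuous γ₃) (hφ : Continuous φ)
    (hφ0 : ∀ w, φ w ≠ 0 → ‖w‖ ≤ 1) (hψ : Continuous ψ) {ε : ℝ} (hε : 0 < ε) (t' : ℝ) :
    ∫ x, heisAverage (heisCurve γ₂ γ₃) a α β
        (fun y => φ (heisShear (ε ^ 2)⁻¹ ε (-d) (-c) y)) x *
        ψ (curveShear γ₂ c d ε t' (x - heisCurve γ₂ γ₃ t')) =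
      (ε ^ 4 : ℝ) * ∫ z, a z.1 * φ z.2 * ψ (curveTransition γ₂ γ₃ c d ε (z, t'))
        ∂((volume.restrict (Set.Icc α β)).prod volume) := by
  have hY := continuous_curveTransition (c := c) (d := d) hγ₂ hγ₃ ε
  simp only [heisAverage, heisShear_heisMul_heisInv_heisCurve]
  simp_rw [← integral_mul_const]
  rw [integral_integral_swap]
  · rw [integral_prod _ (integrable_pairing_slice ha hφ hφ0 hψ (by fun_prop)),
      ← integral_const_mul]
    congr 1
    ext t
    have h := integral_comp_heisShear (R := (ε ^ 2)⁻¹) (e := ε) (by positivity) hε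
      (γ₂ t / 2 - d) (-(t / 2 + c))
      (fun w => a t * φ w * ψ (curveTransition γ₂ γ₃ c d ε ((t, w), t'))) (heisCurve γ₂ γ₃ t)
    -- The volume of an `ε × ε × ε²` box.
    have hdet : ((ε ^ 2 * ((ε ^ 2)⁻¹) ^ 3)⁻¹ : ℝ) = ε ^ 4 := by field_simp
    rw [hdet] at h
    rw [← h]
    congr 1
    ext x
    rw [curveShear_eq_curveTransition hε t t' x]
    rfl
  · exact integrable_mul_curveShear ha hγ₂ hγ₃ hφ hφ0 hψ hε t'

theorem integral_integral_heisAverage_mul_curveShear (ha : Continuous a) (hb : Continuous b)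
    (hbc : HasCompactSupport b)
    (hγ₂ : Continuous γ₂) (hγ₃ : Continuous γ₃) (hφ : Continuous φ) (hφ1 : ∀ w, ‖φ w‖ ≤ 1)
    (hφ0 : ∀ w, φ w ≠ 0 → ‖w‖ ≤ 1) (hψ : Continuous ψ)
    (hψC : ∀ y, ‖ψ y‖ * (1 + ‖y‖) ^ 4 ≤ C) {ε : ℝ} (hε : 0 < ε) :
    ∫ t', b t' * ∫ x, heisAverage (heisCurve γ₂ γ₃) a α β
        (fun y => φ (heisShear (ε ^ 2)⁻¹ ε (-d) (-c) y)) x *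
        ψ (curveShear γ₂ c d ε t' (x - heisCurve γ₂ γ₃ t')) =
      (ε ^ 5 : ℝ) * ∫ q, a q.1.1 * b (q.1.1 + ε * q.2) * φ q.1.2 *
          ψ (curveTransition γ₂ γ₃ c d ε (q.1, q.1.1 + ε * q.2))
        ∂(((volume.restrict (Set.Icc α β)).prod volume).prod volume) := by
  have hY := continuous_curveTransition (c := c) (d := d) hγ₂ hγ₃ ε
  have hi := integrable_pairing_unscaled (α := α) (β := β) ha hb hbc hφ hφ0 hψ hY
  have hu := integral_pairing_unscaled (α := α) (β := β) ha hb hbc hφ hφ1 hφ0 hψ hψC hε hY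
    (fun p => rfl)
  rw [integral_integral_swap hi] at hu
  have e : ((ε ^ 5 : ℝ) : ℂ) = (ε ^ 4 : ℝ) * ε := by push_cast; ring
  rw [e, mul_assoc, ← hu, ← integral_const_mul]
  congr 1
  ext t'
  rw [integral_heisAverage_mul_curveShear ha hγ₂ hγ₃ hφ hφ0 hψ hε, mul_left_comm,
    ← integral_const_mul]
  congr 2
  ext z
  ring

/-- The limit of `curveTransition` at unit time differences in rescaled coordinates. -/
noncomputable def curveTransitionLimit (γ₂ : ℝ → ℝ) (q : (ℝ × HeisSpace) × ℝ) : HeisSpace :=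
  !₂[q.1.2 0 - q.2, q.1.2 1 - q.2 * deriv γ₂ q.1.1,
    q.1.2 2 + (q.2 * deriv γ₂ q.1.1 / 2 * q.1.2 0 - q.2 / 2 * q.1.2 1)]

/-- Only the quotient by `ε²` in the third coordinate is delicate. The contact identity `hcd` makes
its numerator `o((τ - t)²)`, so it disappears in the limit. -/
theorem tendsto_curveTransition (hγ₂ : ContDiff ℝ ∞ γ₂) (hγ₃ : ContDiff ℝ ∞ γ₃)
    (hcd : ∀ t ∈ Set.Icc α β,
      deriv γ₃ t = d + c * deriv γ₂ t + 1 / 2 * (t * deriv γ₂ t - γ₂ t))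
    {t : ℝ} (ht : t ∈ Set.Ioo α β) (w : HeisSpace) (r : ℝ) :
    Filter.Tendsto (fun ε => curveTransition γ₂ γ₃ c d ε ((t, w), t + ε * r))
      (nhdsWithin 0 (Set.Ioi 0)) (nhds (curveTransitionLimit γ₂ ((t, w), r))) := by
  have hd2 : ∀ τ, HasDerivAt γ₂ (deriv γ₂ τ) τ := fun τ =>
    (hγ₂.differentiable (by simp) τ).hasDerivAt
  have hd3 : ∀ τ, HasDerivAt γ₃ (deriv γ₃ τ) τ := fun τ =>
    (hγ₃.differentiable (by simp) τ).hasDerivAt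
  have hc2 : Continuous (deriv γ₂) := hγ₂.continuous_deriv (by simp)
  have h1 := (hd2 t).tendsto_sub_div r
  have h0 : Filter.Tendsto (fun ε : ℝ => (t - (t + ε * r)) / ε) (nhdsWithin 0 (Set.Ioi 0))
      (nhds (-r)) := by
    simpa using (hasDerivAt_id t).tendsto_sub_div r
  -- `G` measures how far `γ(t)` lies from the contact plane at `γ(τ)`. Inserting `hcd` cancels `c`
  -- and `d` in its derivative and leaves two terms that are `o(τ - t)` because `γ₂` is continuously
  -- differentiable.
  set G : ℝ → ℝ := fun τ => γ₃ t - γ₃ τ + (γ₂ τ / 2 - d) * (t - τ) - (τ / 2 + c) * (γ₂ t - γ₂ τ)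
    with hG
  set G' : ℝ → ℝ := fun τ => 1 / 2 * (γ₂ τ - γ₂ t - (τ - t) * deriv γ₂ t) -
    1 / 2 * ((deriv γ₂ τ - deriv γ₂ t) * (τ - t)) with hG'
  have hGd : ∀ᶠ τ in nhds t, HasDerivAt G (G' τ) τ := by
    filter_upwards [Ioo_mem_nhds ht.1 ht.2] with τ hτ
    have h := (((hd3 τ).const_sub (γ₃ t)).add
      ((((hd2 τ).div_const 2).sub_const d).mul ((hasDerivAt_id τ).const_sub t))).sub
      ((((hasDerivAt_id τ).div_const 2).add_const c).mul ((hd2 τ).const_sub (γ₂ t)))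
    refine h.congr_deriv ?_
    rw [hcd τ (Set.Ioo_subset_Icc_self hτ)]
    simp only [hG', id]
    ring
  have hG'o : G' =o[nhds t] fun τ => τ - t := by
    refine Asymptotics.IsLittleO.sub (Asymptotics.IsLittleO.const_mul_left ?_ _)
      (Asymptotics.IsLittleO.const_mul_left ?_ _)
    · simpa using hasDerivAt_iff_isLittleO.1 (hd2 t)
    · have h : (fun τ => deriv γ₂ τ - deriv γ₂ t) =o[nhds t] (fun _ => (1 : ℝ)) := by
        rw [Asymptotics.isLittleO_one_iff]
        simpa using (hc2.tendsto t).sub_const (deriv γ₂ t)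
      simpa using h.mul_isBigO (Asymptotics.isBigO_refl (fun τ => τ - t) (nhds t))
  have hGo := isLittleO_sq_of_hasDerivAt hGd (by simp [hG]) hG'o
  have htl : Filter.Tendsto (fun ε : ℝ => t + ε * r) (nhdsWithin 0 (Set.Ioi 0)) (nhds t) := by
    have : Filter.Tendsto (fun ε : ℝ => t + ε * r) (nhds 0) (nhds (t + 0 * r)) :=
      (by fun_prop : Continuous fun ε : ℝ => t + ε * r).tendsto 0
    simpa using this.mono_left nhdsWithin_le_nhds
  have h2 : Filter.Tendsto (fun ε : ℝ => G (t + ε * r) / ε ^ 2) (nhdsWithin 0 (Set.Ioi 0))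
      (nhds 0) := by
    refine Asymptotics.IsLittleO.tendsto_div_nhds_zero ?_
    refine (hGo.comp_tendsto htl).trans_isBigO ?_
    refine Asymptotics.IsBigO.of_bound (r ^ 2) (Filter.Eventually.of_forall fun ε => ?_)
    simp [mul_pow, mul_comm]
  have h3 : Filter.Tendsto (fun ε : ℝ => w 2 + ((γ₂ (t + ε * r) - γ₂ t) / 2 * w 0 -
      (t + ε * r - t) / 2 * w 1) / ε + G (t + ε * r) / ε ^ 2) (nhdsWithin 0 (Set.Ioi 0))
      (nhds (w 2 + (r * deriv γ₂ t / 2 * w 0 - r / 2 * w 1))) := by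
    have h := (((h1.mul_const (-(w 0) / 2)).sub (h0.mul_const (-(w 1) / 2))).const_add (w 2)).add h2
    refine (h.congr fun ε => by ring).trans (le_of_eq ?_)
    congr 1
    ring
  refine Filter.Tendsto.vec3 ?_ ?_ h3
  · simpa [sub_eq_add_neg] using h0.const_add (w 0)
  · simpa [sub_eq_add_neg] using h1.const_add (w 1)

end HorizontalExample

/-! ### From Sobolev bounds to weighted integrals -/

/-- The point is the order of quantifiers: a single `g` serves all scales, shears and centres, so
test functions may be superposed along the curve before Hölder is applied. -/
theorem exists_pairing_of_sobolevNormLE {s : ℝ} {p : ℝ≥0∞} [Fact (1 ≤ p)] {F : HeisSpace → ℂ}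
    {N : ℝ} (hF : SobolevNormLE s p F N) {χ : HeisSpace → ℂ} (hχ : ContDiff ℝ ∞ χ)
    (hχc : HasCompactSupport χ) (hχ0 : ∀ η : HeisSpace, η 2 < 1 / 4 → χ η = 0) :
    ∃ g : HeisSpace → ℂ, AEStronglyMeasurable g volume ∧
      eLpNorm g p volume ≤ ENNReal.ofReal N ∧
      ∀ R e : ℝ, 0 < R → 0 < e → ∀ (u v : ℝ) (x₀ : HeisSpace),
        ∫ x, F x * 𝓕 χ (heisShear R e u v (x - x₀)) =
          ((R ^ (-s) : ℝ) : ℂ) * ∫ x, g x * 𝓕 (fun η => besselSymbol s χ ((R⁻¹, e, u, v), η))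
            (heisShear R e u v (x - x₀)) := by
  obtain ⟨U, g, hU, hD, hg⟩ := hF
  refine ⟨g, (Lp.memLp g).1, ?_, fun R e hR he u v x₀ => ?_⟩
  · rw [← Lp.enorm_def, ← ofReal_norm]
    exact ENNReal.ofReal_le_ofReal hg
  · rw [← integral_mul_fourier_heisShear_eq hD hχ hχc hχ0 hR he u v x₀]
    refine integral_congr_ae ?_
    filter_upwards [hU] with x hx
    rw [hx]

/-- The weight `(1 + ‖y‖)⁻⁴` with values in `ℝ≥0∞`. -/
noncomputable def decayWeight {V : Type*} [Norm V] (y : V) : ℝ≥0∞ :=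
  ENNReal.ofReal ((1 + ‖y‖) ^ 4)⁻¹

theorem continuous_decayWeight {V : Type*} [NormedAddCommGroup V] :
    Continuous (decayWeight : V → ℝ≥0∞) := by
  refine ENNReal.continuous_ofReal.comp (Continuous.inv₀ (by fun_prop) fun y => ?_)
  have := norm_nonneg y
  positivity

theorem decayWeight_le_one {V : Type*} [NormedAddCommGroup V] (y : V) : decayWeight y ≤ 1 := by
  rw [decayWeight, ← ENNReal.ofReal_one]
  refine ENNReal.ofReal_le_ofReal (inv_le_one_of_one_le₀ (one_le_pow₀ ?_))
  linarith [norm_nonneg y]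

theorem decayWeight_le_of_norm_le {V W : Type*} [NormedAddCommGroup V] [NormedAddCommGroup W]
    {y : V} {z : W} (h : ‖z‖ ≤ ‖y‖) : decayWeight y ≤ decayWeight z := by
  have := norm_nonneg z
  refine ENNReal.ofReal_le_ofReal ?_
  gcongr

theorem enorm_le_mul_decayWeight {ψ : HeisSpace → ℂ} {C : ℝ} {y : HeisSpace}
    (h : ‖ψ y‖ * (1 + ‖y‖) ^ 4 ≤ C) : ‖ψ y‖ₑ ≤ ENNReal.ofReal C * decayWeight y := by
  have := norm_nonneg y
  have hC : 0 ≤ C := le_trans (by positivity) h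
  rw [decayWeight, ← ENNReal.ofReal_mul hC, ← ofReal_norm]
  refine ENNReal.ofReal_le_ofReal ?_
  rw [← div_eq_mul_inv, le_div_iff₀ (by positivity)]
  exact h

theorem lintegral_decayWeight_real_ne_top : ∫⁻ y : ℝ, decayWeight y ≠ ⊤ :=
  (lintegral_inv_one_add_norm_pow_four_lt_top (V := ℝ) volume (by simp)).ne

theorem lintegral_decayWeight_heisSpace_ne_top : ∫⁻ y : HeisSpace, decayWeight y ≠ ⊤ :=
  (lintegral_inv_one_add_norm_pow_four_lt_top (V := HeisSpace) volume (by simp)).ne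

theorem exists_decay_besselSymbol (s : ℝ) {χ : HeisSpace → ℂ} (hχ : ContDiff ℝ ∞ χ)
    (hχc : HasCompactSupport χ) (hχ0 : ∀ η : HeisSpace, η 2 < 1 / 4 → χ η = 0)
    {K : Set (ℝ × ℝ × ℝ × ℝ)} (hK : IsCompact K) :
    ∃ C : ℝ, 0 ≤ C ∧ ∀ θ ∈ K, ∀ y, ‖𝓕 (fun η => besselSymbol s χ (θ, η)) y‖ₑ ≤
      ENNReal.ofReal C * decayWeight y := by
  obtain ⟨C, hC0, hC⟩ := exists_forall_norm_fourier_mul_pow_le (contDiff_besselSymbol s hχ hχ0) hK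
    hχc.isCompact (fun θ η hη => by simp [besselSymbol, image_eq_zero_of_notMem_tsupport hη]) 4
  exact ⟨C, hC0, fun θ hθ y => enorm_le_mul_decayWeight (hC θ hθ y)⟩

theorem exists_decay_fourier {χ : HeisSpace → ℂ} (hχ : ContDiff ℝ ∞ χ)
    (hχc : HasCompactSupport χ) : ∃ C : ℝ, ∀ y, ‖𝓕 χ y‖ * (1 + ‖y‖) ^ 4 ≤ C := by
  obtain ⟨C, -, hC⟩ := exists_forall_norm_fourier_mul_pow_le (Θ := ℝ)
    (F := fun p : ℝ × HeisSpace => χ p.2) (hχ.comp contDiff_snd) (isCompact_singleton (x := 0))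
    hχc.isCompact (fun θ η hη => image_eq_zero_of_notMem_tsupport hη) 4
  exact ⟨C, fun y => hC 0 rfl y⟩

theorem continuous_fourier_of_contDiff {χ : HeisSpace → ℂ} (hχ : ContDiff ℝ ∞ χ)
    (hχc : HasCompactSupport χ) : Continuous (𝓕 χ) := by
  have h := (𝓕 (hχc.toSchwartzMap hχ) : SchwartzMap HeisSpace ℂ).continuous
  rwa [SchwartzMap.fourier_coe] at h

theorem one_div_toReal_mem_Icc {p : ℝ≥0∞} (hp : 1 ≤ p) : (1 / p).toReal ∈ Set.Icc (0 : ℝ) 1 := by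
  refine ⟨ENNReal.toReal_nonneg, ?_⟩
  rw [← ENNReal.toReal_one]
  refine ENNReal.toReal_mono ENNReal.one_ne_top ?_
  rw [one_div]
  exact ENNReal.inv_le_one.2 hp

/-! ### Horizontal example: upper bounds and the exponent -/

section HorizontalExample

variable {α β c d : ℝ} {γ₂ γ₃ : ℝ → ℝ} {a b : ℝ → ℂ} {φ ψ : HeisSpace → ℂ} {C : ℝ}

theorem lintegral_decayWeight_curveShear {ε : ℝ} (hε : 0 < ε) (t : ℝ) :
    ∫⁻ x, decayWeight (curveShear γ₂ c d ε t (x - heisCurve γ₂ γ₃ t)) =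
      ENNReal.ofReal (ε ^ 4) * ∫⁻ y : HeisSpace, decayWeight y := by
  have h := lintegral_comp_heisShear (R := (ε ^ 2)⁻¹) (by positivity) hε (γ₂ t / 2 - d)
    (-(t / 2 + c)) decayWeight (heisCurve γ₂ γ₃ t)
  have hdet : ((ε ^ 2 * ((ε ^ 2)⁻¹) ^ 3)⁻¹ : ℝ) = ε ^ 4 := by field_simp
  rw [hdet] at h
  exact h

/-- The superposition of the rescaled weights along the curve is bounded by `ε` and has mass
`ε ^ 4`. -/
theorem lintegral_mul_lintegral_decayWeight_curveShear_le {p : ℝ≥0∞} (hp : 1 ≤ p)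
    (hγ₂ : Continuous γ₂) (hγ₃ : Continuous γ₃) (hb : Continuous b) {B : ℝ} (hB : ∀ t, ‖b t‖ ≤ B)
    {g : HeisSpace → ℂ} (hg : AEStronglyMeasurable g volume) {ε : ℝ} (hε : 0 < ε) :
    ∫⁻ t, ‖b t‖ₑ * ∫⁻ x, ‖g x‖ₑ *
        decayWeight (curveShear γ₂ c d ε t (x - heisCurve γ₂ γ₃ t)) ≤
      eLpNorm g p volume *
        ((ENNReal.ofReal B * (ENNReal.ofReal ε * ∫⁻ y : ℝ, decayWeight y)) ^ (1 / p).toReal *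
        ((∫⁻ t, ‖b t‖ₑ) * (ENNReal.ofReal (ε ^ 4) * ∫⁻ y : HeisSpace, decayWeight y)) ^
          (1 - (1 / p).toReal)) := by
  have hJ' : Continuous fun q : ℝ × HeisSpace =>
      decayWeight (curveShear γ₂ c d ε q.1 (q.2 - heisCurve γ₂ γ₃ q.1)) :=
    continuous_decayWeight.comp (Continuous.curveShear_sub continuous_fst continuous_snd hγ₂ hγ₃ ε)
  have hJ : Measurable fun q : ℝ × HeisSpace =>
      ‖b q.1‖ₑ * decayWeight (curveShear γ₂ c d ε q.1 (q.2 - heisCurve γ₂ γ₃ q.1)) :=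
    (hb.enorm.measurable.comp measurable_fst).mul hJ'.measurable
  have hW : Measurable fun x : HeisSpace => ∫⁻ t, ‖b t‖ₑ *
      decayWeight (curveShear γ₂ c d ε t (x - heisCurve γ₂ γ₃ t)) :=
    hJ.lintegral_prod_left'
  have hgm : AEMeasurable (Function.uncurry fun (t : ℝ) (x : HeisSpace) => ‖g x‖ₑ * (‖b t‖ₑ *
      decayWeight (curveShear γ₂ c d ε t (x - heisCurve γ₂ γ₃ t))))
      ((volume : Measure ℝ).prod volume) :=
    (hg.enorm.comp_quasiMeasurePreserving Measure.quasiMeasurePreserving_snd).mul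
      hJ.aemeasurable
  have h1 : ∫⁻ t, ‖b t‖ₑ * ∫⁻ x, ‖g x‖ₑ *
        decayWeight (curveShear γ₂ c d ε t (x - heisCurve γ₂ γ₃ t)) =
      ∫⁻ x, ‖g x‖ₑ * ∫⁻ t, ‖b t‖ₑ *
        decayWeight (curveShear γ₂ c d ε t (x - heisCurve γ₂ γ₃ t)) := by
    calc _ = ∫⁻ t, ∫⁻ x, ‖g x‖ₑ * (‖b t‖ₑ *
          decayWeight (curveShear γ₂ c d ε t (x - heisCurve γ₂ γ₃ t))) := by
          refine lintegral_congr fun t => ?_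
          rw [← lintegral_const_mul' _ _ enorm_ne_top]
          exact lintegral_congr fun x => by ring
      _ = ∫⁻ x, ∫⁻ t, ‖g x‖ₑ * (‖b t‖ₑ *
          decayWeight (curveShear γ₂ c d ε t (x - heisCurve γ₂ γ₃ t))) :=
          lintegral_lintegral_swap hgm
      _ = _ := lintegral_congr fun x => lintegral_const_mul' _ _ enorm_ne_top
  rw [h1]
  refine lintegral_enorm_mul_le_of_le hp hg hW.aemeasurable (fun x => ?_) ?_
  -- The first rescaled coordinate is `(x₁ - t)/ε`, so a given point is seen only by times in an
  -- interval of length about `ε`.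
  · calc _ ≤ ∫⁻ t, ENNReal.ofReal B * decayWeight ((x 0 - t) / ε) := by
          refine lintegral_mono fun t => ?_
          gcongr
          · rw [← ofReal_norm]; exact ENNReal.ofReal_le_ofReal (hB t)
          · refine decayWeight_le_of_norm_le ?_
            have h := abs_coord_le (curveShear γ₂ c d ε t (x - heisCurve γ₂ γ₃ t)) 0
            refine le_trans (le_of_eq ?_) h
            rw [Real.norm_eq_abs]
            congr 1
            simp only [curveShear, heisShear_apply, heisCurve]
            simp
            field_simp
      _ = _ := by
          rw [lintegral_const_mul' _ _ ENNReal.ofReal_ne_top,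
            lintegral_comp_sub_div continuous_decayWeight.measurable hε]
  · rw [lintegral_lintegral_swap (by
      exact (hJ.comp measurable_swap).aemeasurable)]
    have : ∀ t, ∫⁻ x, ‖b t‖ₑ * decayWeight (curveShear γ₂ c d ε t (x - heisCurve γ₂ γ₃ t)) =
        ‖b t‖ₑ * (ENNReal.ofReal (ε ^ 4) * ∫⁻ y : HeisSpace, decayWeight y) := fun t => by
      rw [lintegral_const_mul' _ _ enorm_ne_top, lintegral_decayWeight_curveShear hε]
    simp_rw [this]
    rw [lintegral_mul_const _ hb.enorm.measurable]

/-- The rescaled bump functions at the origin are supported in a fixed compact set. -/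
theorem exists_isCompact_support_heisShear (c d : ℝ) : ∃ K : Set HeisSpace, IsCompact K ∧
    ∀ ε ∈ Set.Ioc (0 : ℝ) 1, ∀ φ : HeisSpace → ℂ, (∀ w, φ w ≠ 0 → ‖w‖ ≤ 1) →
      Function.support (fun y => φ (heisShear (ε ^ 2)⁻¹ ε (-d) (-c) y)) ⊆ K := by
  have hcont : Continuous fun p : ℝ × HeisSpace =>
      (!₂[p.1 * p.2 0, p.1 * p.2 1, p.1 ^ 2 * p.2 2 + d * (p.1 * p.2 0) + c * (p.1 * p.2 1)] :
        HeisSpace) := Continuous.vec3 (by fun_prop) (by fun_prop) (by fun_prop)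
  refine ⟨_, ((isCompact_Icc (a := (0 : ℝ)) (b := 1)).prod
    (isCompact_closedBall (0 : HeisSpace) 1)).image hcont, fun ε hε φ hφ0 y hy => ?_⟩
  have hε0 : ε ≠ 0 := hε.1.ne'
  refine ⟨(ε, heisShear (ε ^ 2)⁻¹ ε (-d) (-c) y), ⟨Set.Ioc_subset_Icc_self hε,
    by simpa only [mem_closedBall_zero_iff] using hφ0 _ hy⟩, ?_⟩
  ext i
  fin_cases i <;> simp [heisShear_apply] <;> field_simp
  ring

theorem lintegral_enorm_le_volume_closedBall (hφ1 : ∀ w, ‖φ w‖ ≤ 1)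
    (hφ0 : ∀ w, φ w ≠ 0 → ‖w‖ ≤ 1) :
    ∫⁻ w, ‖φ w‖ₑ ≤ volume (Metric.closedBall (0 : HeisSpace) 1) := by
  rw [← lintegral_indicator_one measurableSet_closedBall]
  refine lintegral_mono fun w => ?_
  by_cases hw : φ w = 0
  · simp [hw]
  · rw [Set.indicator_of_mem (by simpa using hφ0 w hw), ← ofReal_norm, Pi.one_apply,
      ← ENNReal.ofReal_one]
    exact ENNReal.ofReal_le_ofReal (hφ1 w)

theorem eLpNorm_comp_heisShear_le {p : ℝ≥0∞} (hp : 1 ≤ p) (hφ : Continuous φ)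
    (hφ1 : ∀ w, ‖φ w‖ ≤ 1) (hφ0 : ∀ w, φ w ≠ 0 → ‖w‖ ≤ 1) {ε : ℝ} (hε : 0 < ε) (u v : ℝ) :
    eLpNorm (fun y => φ (heisShear (ε ^ 2)⁻¹ ε u v y)) p volume ≤
      (ENNReal.ofReal (ε ^ 4) * volume (Metric.closedBall (0 : HeisSpace) 1)) ^
        (1 / p).toReal := by
  have hc : Continuous fun y => φ (heisShear (ε ^ 2)⁻¹ ε u v y) :=
    hφ.comp (continuous_heisShear _ _ _ _)
  have h1 : ∀ w, ‖φ w‖ₑ ≤ 1 := fun w => by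
    rw [← ofReal_norm, ← ENNReal.ofReal_one]; exact ENNReal.ofReal_le_ofReal (hφ1 w)
  have h := eLpNorm_le_of_le_of_lintegral_le (μ := volume) hp hc.aestronglyMeasurable (A := 1)
    (B := ENNReal.ofReal (ε ^ 4) * volume (Metric.closedBall (0 : HeisSpace) 1))
    (fun y => h1 _) ?_
  · simpa using h
  · have h3 := lintegral_comp_heisShear (R := (ε ^ 2)⁻¹) (by positivity) hε u v
      (fun w => ‖φ w‖ₑ) 0
    have hdet : ((ε ^ 2 * ((ε ^ 2)⁻¹) ^ 3)⁻¹ : ℝ) = ε ^ 4 := by field_simp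
    simp only [sub_zero, hdet] at h3
    rw [h3]
    gcongr
    exact lintegral_enorm_le_volume_closedBall hφ1 hφ0

theorem lintegral_enorm_ne_top_of_hasCompactSupport (hb : Continuous b) (hbc : HasCompactSupport b) :
    ∫⁻ t, ‖b t‖ₑ ≠ ⊤ :=
  (hb.integrable_of_hasCompactSupport hbc).2.ne

/-- The bump lives on an `ε × ε × ε²` box and is tested along the whole curve. A single test
function would have a weight of supremum about 1 and mass about `ε ^ 4`, giving only `s ≤ 1/2`;
averaging over `t'` lowers the supremum to about `ε` at the same order of mass and gains `ε ^
(1/p)`. -/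
theorem le_half_of_boundedLpCompToSobolev (hγ₂ : ContDiff ℝ ∞ γ₂) (hγ₃ : ContDiff ℝ ∞ γ₃)
    (hcd : ∀ t ∈ Set.Icc α β,
      deriv γ₃ t = d + c * deriv γ₂ t + 1 / 2 * (t * deriv γ₂ t - γ₂ t))
    (ha : Continuous a) {t₀ : ℝ} (ht₀ : t₀ ∈ Set.Ioo α β) (ha₀ : a t₀ ≠ 0)
    {p : ℝ≥0∞} [Fact (1 ≤ p)] {s : ℝ}
    (hA : BoundedLpCompToSobolev (heisAverage (heisCurve γ₂ γ₃) a α β) p s) :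
    s ≤ 1 / 2 * (1 - (1 / p).toReal) := by
  have hp : 1 ≤ p := Fact.out
  obtain ⟨hθ0, hθ1⟩ := one_div_toReal_mem_Icc hp
  set θ := (1 / p).toReal with hθ
  have hγ₂c := hγ₂.continuous
  have hγ₃c := hγ₃.continuous
  have hdγ₂ : Continuous (deriv γ₂) := hγ₂.continuous_deriv (by simp)
  obtain ⟨χ, hχ, hχc, hχ0, hχpos, hχne⟩ := exists_testFunction
  obtain ⟨Cψ, hψC⟩ := exists_decay_fourier hχ hχc
  have hψ := continuous_fourier_of_contDiff hχ hχc
  have hZ₀ : Continuous (curveTransitionLimit γ₂) :=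
    Continuous.vec3 (by fun_prop) (by fun_prop) (by fun_prop)
  obtain ⟨b, φ, hb, hbc, hφ, hφ1, hφ0, hlow⟩ := exists_pairing_lower_bound ht₀ ha ha₀ hψ hψC hZ₀
    (fun q => rfl) (fun r => hχpos _ (by simp [curveTransitionLimit]))
    (by
      have : curveTransitionLimit γ₂ ((t₀, 0), 0) = 0 := by
        ext i; fin_cases i <;> simp [curveTransitionLimit]
      rwa [this])
  obtain ⟨k, hk, hlow⟩ := hlow
    (fun ε q => curveTransition γ₂ γ₃ c d ε (q.1, q.1.1 + ε * q.2))
    (fun ε _ => (continuous_curveTransition hγ₂c hγ₃c ε).comp (by fun_prop))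
    (fun ε hε q => by
      have : ε ≠ 0 := ne_of_gt hε
      simp only [curveTransition]
      simp
      field_simp
      ring)
    (fun t ht w r => tendsto_curveTransition hγ₂ hγ₃ hcd ht w r)
  obtain ⟨K, hK, hKsupp⟩ := exists_isCompact_support_heisShear c d
  obtain ⟨N, hN⟩ := hA K hK
  -- With `R = ε⁻²` the symbol parameters are `(ε², ε, …)`. They extend continuously to `ε = 0`, so
  -- `[0, 1]` times the support of `b` has compact image.
  have hpar : Continuous fun q : ℝ × ℝ => (q.1 ^ 2, q.1, γ₂ q.2 / 2 - d, -(q.2 / 2 + c)) := by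
    fun_prop
  obtain ⟨C, hC0, hC⟩ := exists_decay_besselSymbol s hχ hχc hχ0
    (((isCompact_Icc (a := (0 : ℝ)) (b := 1)).prod hbc.isCompact).image hpar)
  obtain ⟨B, hB⟩ := hb.bounded_above_of_compact_support hbc
  have hB0 : 0 ≤ B := (norm_nonneg _).trans (hB 0)
  set A₀ : ℝ := B * (∫⁻ y : ℝ, decayWeight y).toReal with hA₀
  set B₀ : ℝ := (∫⁻ t, ‖b t‖ₑ).toReal * (∫⁻ y : HeisSpace, decayWeight y).toReal with hB₀
  set V₀ : ℝ := (volume (Metric.closedBall (0 : HeisSpace) 1)).toReal with hV₀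
  have hA₀0 : 0 ≤ A₀ := mul_nonneg hB0 ENNReal.toReal_nonneg
  have hB₀0 : 0 ≤ B₀ := mul_nonneg ENNReal.toReal_nonneg ENNReal.toReal_nonneg
  have hV₀0 : 0 ≤ V₀ := ENNReal.toReal_nonneg
  -- Sources of the powers: `2s` from `R ^ (-s)`, `4θ` from `‖f‖_p`, `θ` and `4(1 - θ)` from the
  -- supremum and mass of the weight; the lower bound is of order `ε ^ 5`.
  suffices h : 2 * s + 4 * θ + θ + 4 * (1 - θ) ≤ 5 by linarith
  refine exponent_le_of_eventually_le (c := k)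
    (D := C * (max N 0 * V₀ ^ θ) * (A₀ ^ θ * B₀ ^ (1 - θ))) hk ?_
  filter_upwards [hlow, Ioc_mem_nhdsGT (zero_lt_one' ℝ)] with ε hlε hε
  have hε0 : 0 < ε := hε.1
  set f : HeisSpace → ℂ := fun y => φ (heisShear (ε ^ 2)⁻¹ ε (-d) (-c) y) with hf
  have hfc : Continuous f := hφ.comp (continuous_heisShear _ _ _ _)
  have hfK : Function.support f ⊆ K := hKsupp ε hε φ hφ0
  have hfL : MemLp f p volume :=
    hfc.memLp_of_hasCompactSupport (HasCompactSupport.intro hK fun x hx => by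
      by_contra h; exact hx (hfK h))
  have hfn : (eLpNorm f p volume).toReal ≤ (ε ^ 4 * V₀) ^ θ := by
    refine ENNReal.toReal_le_of_le_ofReal (by positivity)
      ((eLpNorm_comp_heisShear_le hp hφ hφ1 hφ0 hε0 (-d) (-c)).trans (le_of_eq ?_))
    rw [← ENNReal.ofReal_rpow_of_nonneg (by positivity) hθ0, ENNReal.ofReal_mul (by positivity),
      hV₀, ENNReal.ofReal_toReal (isCompact_closedBall _ _).measure_lt_top.ne]
  obtain ⟨g, hgm, hgn, hgp⟩ := exists_pairing_of_sobolevNormLE (hN f hfL hfK) hχ hχc hχ0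
  have hmain := integral_integral_heisAverage_mul_curveShear (α := α) (β := β) (c := c) (d := d)
    ha hb hbc hγ₂c hγ₃c hφ hφ1 hφ0 hψ hψC hε0
  have hupper : ‖∫ t', b t' * ∫ x, heisAverage (heisCurve γ₂ γ₃) a α β f x *
      𝓕 χ (curveShear γ₂ c d ε t' (x - heisCurve γ₂ γ₃ t'))‖ₑ ≤
      ENNReal.ofReal ((ε ^ 2)⁻¹ ^ (-s) * C) * ∫⁻ t, ‖b t‖ₑ * ∫⁻ x, ‖g x‖ₑ *
        decayWeight (curveShear γ₂ c d ε t (x - heisCurve γ₂ γ₃ t)) := by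
    rw [← lintegral_const_mul' _ _ ENNReal.ofReal_ne_top]
    refine (enorm_integral_le_lintegral_enorm _).trans (lintegral_mono fun t => ?_)
    -- The uniform decay constant is available only for times in the support of `b`.
    by_cases hbt : b t = 0
    · simp [hbt]
    have hθt : ((ε ^ 2)⁻¹⁻¹, ε, γ₂ t / 2 - d, -(t / 2 + c)) ∈
        (fun q : ℝ × ℝ => (q.1 ^ 2, q.1, γ₂ q.2 / 2 - d, -(q.2 / 2 + c))) ''
          (Set.Icc (0 : ℝ) 1 ×ˢ tsupport b) :=
      ⟨(ε, t), ⟨Set.Ioc_subset_Icc_self hε, subset_tsupport _ hbt⟩, by simp⟩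
    have h1 := hgp (ε ^ 2)⁻¹ ε (by positivity) hε0 (γ₂ t / 2 - d) (-(t / 2 + c))
      (heisCurve γ₂ γ₃ t)
    simp only [curveShear]
    rw [h1, enorm_mul, enorm_mul, mul_left_comm]
    have h2 : ‖(((ε ^ 2)⁻¹ ^ (-s) : ℝ) : ℂ)‖ₑ = ENNReal.ofReal ((ε ^ 2)⁻¹ ^ (-s)) := by
      rw [← ofReal_norm, Complex.norm_real, Real.norm_of_nonneg (by positivity)]
    have h3 : ‖∫ x, g x * 𝓕 (fun η => besselSymbol s χ
        (((ε ^ 2)⁻¹⁻¹, ε, γ₂ t / 2 - d, -(t / 2 + c)), η))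
          (curveShear γ₂ c d ε t (x - heisCurve γ₂ γ₃ t))‖ₑ ≤
        ENNReal.ofReal C * ∫⁻ x, ‖g x‖ₑ *
          decayWeight (curveShear γ₂ c d ε t (x - heisCurve γ₂ γ₃ t)) := by
      rw [← lintegral_const_mul' _ _ ENNReal.ofReal_ne_top]
      refine (enorm_integral_le_lintegral_enorm _).trans (lintegral_mono fun x => ?_)
      rw [enorm_mul, mul_left_comm]
      gcongr
      exact hC _ hθt _
    rw [h2, ENNReal.ofReal_mul (by positivity), mul_assoc, mul_left_comm (ENNReal.ofReal C)]
    exact mul_le_mul_right (mul_le_mul_right h3 _) _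
  have hweight := lintegral_mul_lintegral_decayWeight_curveShear_le (c := c) (d := d) hp
    hγ₂c hγ₃c hb hB hgm hε0
  have e1 : ENNReal.ofReal B * (ENNReal.ofReal ε * ∫⁻ y : ℝ, decayWeight y) =
      ENNReal.ofReal (ε * A₀) := by
    rw [hA₀, ENNReal.ofReal_mul hε0.le, ENNReal.ofReal_mul hB0,
      ENNReal.ofReal_toReal lintegral_decayWeight_real_ne_top]
    ring
  have e2 : (∫⁻ t, ‖b t‖ₑ) * (ENNReal.ofReal (ε ^ 4) * ∫⁻ y : HeisSpace, decayWeight y) =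
      ENNReal.ofReal (ε ^ 4 * B₀) := by
    rw [hB₀, ENNReal.ofReal_mul (by positivity), ENNReal.ofReal_mul ENNReal.toReal_nonneg,
      ENNReal.ofReal_toReal lintegral_decayWeight_heisSpace_ne_top,
      ENNReal.ofReal_toReal (lintegral_enorm_ne_top_of_hasCompactSupport hb hbc)]
    ring
  rw [e1, e2, ← hθ, ENNReal.ofReal_rpow_of_nonneg (by positivity) hθ0,
    ENNReal.ofReal_rpow_of_nonneg (by positivity) (by linarith),
    ← ENNReal.ofReal_mul (by positivity)] at hweight
  have hg2 : eLpNorm g p volume ≤ ENNReal.ofReal (max N 0 * (ε ^ 4 * V₀) ^ θ) := by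
    refine hgn.trans (ENNReal.ofReal_le_ofReal ?_)
    calc N * (eLpNorm f p volume).toReal ≤ max N 0 * (eLpNorm f p volume).toReal := by
          gcongr; exact le_max_left _ _
      _ ≤ _ := by gcongr
  have htotal : ‖∫ t', b t' * ∫ x, heisAverage (heisCurve γ₂ γ₃) a α β f x *
      𝓕 χ (curveShear γ₂ c d ε t' (x - heisCurve γ₂ γ₃ t'))‖ ≤
      ((ε ^ 2)⁻¹ ^ (-s) * C) * ((max N 0 * (ε ^ 4 * V₀) ^ θ) *
        ((ε * A₀) ^ θ * (ε ^ 4 * B₀) ^ (1 - θ))) := by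
    rw [← ENNReal.ofReal_le_ofReal_iff (by positivity), ofReal_norm,
      ENNReal.ofReal_mul (by positivity), ENNReal.ofReal_mul (p := max N 0 * _) (by positivity)]
    exact hupper.trans (mul_le_mul_right (hweight.trans (mul_le_mul_left hg2 _)) _)
  rw [hmain, norm_mul, Complex.norm_real, Real.norm_of_nonneg (by positivity)] at htotal
  have hR : ((ε ^ 2)⁻¹ : ℝ) ^ (-s) = ε ^ (2 * s) := by
    rw [Real.inv_rpow (by positivity), Real.rpow_neg (by positivity), inv_inv,
      ← Real.rpow_natCast, ← Real.rpow_mul hε0.le]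
    norm_num
  have h4 : ∀ x : ℝ, (ε ^ 4) ^ x = ε ^ (4 * x) := fun x => by
    rw [← Real.rpow_natCast, ← Real.rpow_mul hε0.le]; norm_num
  calc k * ε ^ (5 : ℝ) = ε ^ 5 * k := by
        rw [mul_comm]; congr 1; exact_mod_cast Real.rpow_natCast ε 5
    _ ≤ ε ^ 5 * _ := by gcongr
    _ ≤ _ := htotal
    _ = _ := by
      rw [hR, Real.mul_rpow (by positivity) hV₀0, Real.mul_rpow hε0.le hA₀0,
        Real.mul_rpow (by positivity) hB₀0, h4, h4, Real.rpow_add hε0, Real.rpow_add hε0,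
        Real.rpow_add hε0]
      ring

end HorizontalExample

/-! ### Tube example -/

section TubeExample

variable {α β u : ℝ} {γ₂ γ₃ : ℝ → ℝ} {a b : ℝ → ℂ} {φ ψ : HeisSpace → ℂ} {C : ℝ}

/-- A bump function adapted to the `δ`-neighbourhood of the curve `t ↦ γ(t)⁻¹`. -/
noncomputable def tubeBump (γ₂ γ₃ : ℝ → ℝ) (b : ℝ → ℂ) (φ : HeisSpace → ℂ) (u δ : ℝ)
    (y : HeisSpace) : ℂ :=
  (δ⁻¹ : ℝ) * ∫ t, b t * φ (heisShear δ⁻¹ 1 u 0 (heisMul (heisCurve γ₂ γ₃ t) y))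

/-- The transition map for the isotropic rescaling by `δ`. -/
noncomputable def tubeTransition (γ₂ γ₃ : ℝ → ℝ) (u δ : ℝ) (p : (ℝ × HeisSpace) × ℝ) :
    HeisSpace :=
  !₂[p.1.2 0 + (p.1.1 - p.2) / δ, p.1.2 1 + (γ₂ p.1.1 - γ₂ p.2) / δ,
    p.1.2 2 + (γ₃ p.1.1 - γ₃ p.2 + 1 / 2 * (γ₂ p.1.1 * p.2 - p.1.1 * γ₂ p.2)) / δ +
      u * ((p.1.1 - p.2) / δ) +
      1 / 2 * ((p.1.1 - p.2) * p.1.2 1 - (γ₂ p.1.1 - γ₂ p.2) * p.1.2 0)]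

/-- Here `f` carries the superposition over `t'` and the test function sits at the origin. The
relative position of the two is governed by `γ(t) ⊙ γ(t')⁻¹`. -/
theorem heisShear_eq_tubeTransition {δ : ℝ} (hδ : 0 < δ) (t t' : ℝ) (x : HeisSpace) :
    heisShear δ⁻¹ 1 u 0 x = tubeTransition γ₂ γ₃ u δ
      ((t, heisShear δ⁻¹ 1 u 0 (heisMul (heisCurve γ₂ γ₃ t')
        (heisMul (heisInv (heisCurve γ₂ γ₃ t)) x))), t') := by
  ext i
  fin_cases i <;> simp [tubeTransition, heisShear_apply, heisCurve, heisMul, heisInv,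
    -mul_eq_mul_left_iff] <;> field_simp <;> ring

theorem continuous_tubeTransition (hγ₂ : Continuous γ₂) (hγ₃ : Continuous γ₃) (δ : ℝ) :
    Continuous (tubeTransition γ₂ γ₃ u δ) :=
  Continuous.vec3 (by fun_prop) (by fun_prop) (by fun_prop)

/-- The limit of `tubeTransition` at unit time differences in rescaled coordinates. -/
noncomputable def tubeTransitionLimit (γ₂ γ₃ : ℝ → ℝ) (u : ℝ) (q : (ℝ × HeisSpace) × ℝ) :
    HeisSpace :=
  !₂[q.1.2 0 - q.2, q.1.2 1 - q.2 * deriv γ₂ q.1.1,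
    q.1.2 2 - q.2 * (deriv γ₃ q.1.1 + 1 / 2 * (q.1.1 * deriv γ₂ q.1.1 - γ₂ q.1.1)) - u * q.2]

theorem tendsto_tubeTransition (hγ₂ : ContDiff ℝ ∞ γ₂) (hγ₃ : ContDiff ℝ ∞ γ₃)
    (t : ℝ) (w : HeisSpace) (r : ℝ) :
    Filter.Tendsto (fun δ => tubeTransition γ₂ γ₃ u δ ((t, w), t + δ * r))
      (nhdsWithin 0 (Set.Ioi 0)) (nhds (tubeTransitionLimit γ₂ γ₃ u ((t, w), r))) := by
  have hd2 : HasDerivAt γ₂ (deriv γ₂ t) t := (hγ₂.differentiable (by simp) t).hasDerivAt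
  have hd3 : HasDerivAt γ₃ (deriv γ₃ t) t := (hγ₃.differentiable (by simp) t).hasDerivAt
  have h1 := hd2.tendsto_sub_div r
  have h0 : Filter.Tendsto (fun δ : ℝ => (t - (t + δ * r)) / δ) (nhdsWithin 0 (Set.Ioi 0))
      (nhds (-r)) := by
    simpa using (hasDerivAt_id t).tendsto_sub_div r
  have h3 := (hd3.sub ((((hasDerivAt_id t).const_mul (γ₂ t)).sub
    (hd2.const_mul t)).const_mul (1 / 2))).tendsto_sub_div r
  have htl : Filter.Tendsto (fun δ : ℝ => t + δ * r) (nhdsWithin 0 (Set.Ioi 0)) (nhds t) := by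
    have : Filter.Tendsto (fun δ : ℝ => t + δ * r) (nhds 0) (nhds (t + 0 * r)) :=
      (by fun_prop : Continuous fun δ : ℝ => t + δ * r).tendsto 0
    simpa using this.mono_left nhdsWithin_le_nhds
  have h4 : Filter.Tendsto (fun δ : ℝ => 1 / 2 * ((t - (t + δ * r)) * w 1 -
      (γ₂ t - γ₂ (t + δ * r)) * w 0)) (nhdsWithin 0 (Set.Ioi 0)) (nhds 0) := by
    have := (((htl.const_sub t).mul_const (w 1)).sub
      ((((hγ₂.continuous.tendsto t).comp htl).const_sub (γ₂ t)).mul_const (w 0))).const_mul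
        (1 / 2 : ℝ)
    simpa using this
  refine Filter.Tendsto.vec3 ?_ ?_ ?_
  · simpa [sub_eq_add_neg] using h0.const_add (w 0)
  · simpa [sub_eq_add_neg] using h1.const_add (w 1)
  · have h := ((h3.const_add (w 2)).add (h0.const_mul u)).add h4
    refine (h.congr fun δ => ?_).trans (le_of_eq ?_)
    · simp only [Pi.sub_apply, id]
      ring
    · congr 1
      ring

theorem continuous_heisShear_heisMul_heisCurve (hγ₂ : Continuous γ₂) (hγ₃ : Continuous γ₃)
    (δ : ℝ) : Continuous fun q : HeisSpace × ℝ =>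
      heisShear δ⁻¹ 1 u 0 (heisMul (heisCurve γ₂ γ₃ q.2) q.1) :=
  (continuous_heisShear _ _ _ _).comp (Continuous.comp (g := fun p : HeisSpace × HeisSpace =>
    heisMul p.1 p.2) continuous_heisMul
    (((continuous_heisCurve hγ₂ hγ₃).comp continuous_snd).prodMk continuous_fst))

theorem continuous_tubeBump (hγ₂ : Continuous γ₂) (hγ₃ : Continuous γ₃) (hb : Continuous b)
    (hbc : HasCompactSupport b) (hφ : Continuous φ) (δ : ℝ) :
    Continuous (tubeBump γ₂ γ₃ b φ u δ) := by
  have hc : Continuous (Function.uncurry fun (y : HeisSpace) (t : ℝ) =>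
      b t * φ (heisShear δ⁻¹ 1 u 0 (heisMul (heisCurve γ₂ γ₃ t) y))) :=
    (hb.comp continuous_snd).mul
      (hφ.comp (continuous_heisShear_heisMul_heisCurve hγ₂ hγ₃ δ))
  have h := continuous_parametric_integral_of_continuous (μ := volume) hc hbc.isCompact
  have heq : ∀ y, ∫ t in tsupport b, b t *
      φ (heisShear δ⁻¹ 1 u 0 (heisMul (heisCurve γ₂ γ₃ t) y)) =
      ∫ t, b t * φ (heisShear δ⁻¹ 1 u 0 (heisMul (heisCurve γ₂ γ₃ t) y)) := fun y =>
    setIntegral_eq_integral_of_forall_compl_eq_zero fun t ht => by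
      rw [image_eq_zero_of_notMem_tsupport ht, zero_mul]
  simp only [heq] at h
  exact continuous_const.mul h

theorem exists_isCompact_support_tubeBump (hγ₂ : Continuous γ₂) (hγ₃ : Continuous γ₃)
    (hbc : HasCompactSupport b) (hφ0 : ∀ w, φ w ≠ 0 → ‖w‖ ≤ 1) (u : ℝ) :
    ∃ K : Set HeisSpace, IsCompact K ∧
      ∀ δ ∈ Set.Ioc (0 : ℝ) 1, Function.support (tubeBump γ₂ γ₃ b φ u δ) ⊆ K := by
  have hcont : Continuous fun p : ℝ × ℝ × HeisSpace => heisMul (heisInv (heisCurve γ₂ γ₃ p.1))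
      (!₂[p.2.1 * p.2.2 0, p.2.1 * p.2.2 1, p.2.1 * p.2.2 2 - u * (p.2.1 * p.2.2 0)]) :=
    Continuous.comp (g := fun p : HeisSpace × HeisSpace => heisMul p.1 p.2) continuous_heisMul
      ((((continuous_heisCurve hγ₂ hγ₃).comp continuous_fst).neg).prodMk
        (Continuous.vec3 (by fun_prop) (by fun_prop) (by fun_prop)))
  refine ⟨_, (hbc.isCompact.prod ((isCompact_Icc (a := (0 : ℝ)) (b := 1)).prod
    (isCompact_closedBall (0 : HeisSpace) 1))).image hcont, fun δ hδ y hy => ?_⟩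
  have hδ0 : δ ≠ 0 := hδ.1.ne'
  have : ∃ t, b t * φ (heisShear δ⁻¹ 1 u 0 (heisMul (heisCurve γ₂ γ₃ t) y)) ≠ 0 := by
    by_contra! h
    exact hy (by simp [tubeBump, h])
  obtain ⟨t, ht⟩ := this
  refine ⟨(t, δ, heisShear δ⁻¹ 1 u 0 (heisMul (heisCurve γ₂ γ₃ t) y)),
    ⟨subset_tsupport _ (left_ne_zero_of_mul ht), Set.Ioc_subset_Icc_self hδ,
      by simpa only [mem_closedBall_zero_iff] using hφ0 _ (right_ne_zero_of_mul ht)⟩, ?_⟩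
  refine Eq.trans ?_ (heisInv_heisMul_cancel_left (heisCurve γ₂ γ₃ t) y)
  generalize heisMul (heisCurve γ₂ γ₃ t) y = z
  refine congrArg (heisMul (heisInv (heisCurve γ₂ γ₃ t))) ?_
  ext i
  fin_cases i <;> simp [heisShear_apply] <;> field_simp
  ring

theorem enorm_le_decayWeight_of_bump (hφ1 : ∀ w, ‖φ w‖ ≤ 1) (hφ0 : ∀ w, φ w ≠ 0 → ‖w‖ ≤ 1)
    (w : HeisSpace) : ‖φ w‖ₑ ≤ ENNReal.ofReal 16 * decayWeight w := by
  refine enorm_le_mul_decayWeight ?_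
  by_cases hw : φ w = 0
  · simp [hw]
  · have h1 := hφ0 w hw
    calc ‖φ w‖ * (1 + ‖w‖) ^ 4 ≤ 1 * (1 + 1) ^ 4 := by
          gcongr
          exact hφ1 w
      _ = 16 := by norm_num

/-- The first coordinate of the argument of `φ` is `(t + y₁)/δ`, so only times in an interval of
length about `δ` contribute, which the prefactor `δ⁻¹` compensates. -/
theorem enorm_tubeBump_le (hφ1 : ∀ w, ‖φ w‖ ≤ 1) (hφ0 : ∀ w, φ w ≠ 0 → ‖w‖ ≤ 1) {B : ℝ}
    (hB : ∀ t, ‖b t‖ ≤ B) {δ : ℝ} (hδ : 0 < δ) (y : HeisSpace) :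
    ‖tubeBump γ₂ γ₃ b φ u δ y‖ₑ ≤
      ENNReal.ofReal B * (ENNReal.ofReal 16 * ∫⁻ y : ℝ, decayWeight y) := by
  have hinv : ‖((δ⁻¹ : ℝ) : ℂ)‖ₑ = ENNReal.ofReal δ⁻¹ := by
    rw [← ofReal_norm, Complex.norm_real, Real.norm_of_nonneg (by positivity)]
  rw [tubeBump, enorm_mul, hinv]
  have h1 : ‖∫ t, b t * φ (heisShear δ⁻¹ 1 u 0 (heisMul (heisCurve γ₂ γ₃ t) y))‖ₑ ≤
      ENNReal.ofReal B * (ENNReal.ofReal 16 * (ENNReal.ofReal δ * ∫⁻ y : ℝ, decayWeight y)) := by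
    refine (enorm_integral_le_lintegral_enorm _).trans ?_
    rw [← lintegral_comp_sub_div continuous_decayWeight.measurable hδ (-(y 0)),
      ← lintegral_const_mul' _ _ ENNReal.ofReal_ne_top,
      ← lintegral_const_mul' _ _ ENNReal.ofReal_ne_top]
    refine lintegral_mono fun t => ?_
    rw [enorm_mul]
    gcongr
    · rw [← ofReal_norm]; exact ENNReal.ofReal_le_ofReal (hB t)
    · refine (enorm_le_decayWeight_of_bump hφ1 hφ0 _).trans ?_
      gcongr
      refine decayWeight_le_of_norm_le ?_
      have h := abs_coord_le (heisShear δ⁻¹ 1 u 0 (heisMul (heisCurve γ₂ γ₃ t) y)) 0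
      refine le_trans (le_of_eq ?_) h
      rw [Real.norm_eq_abs, ← abs_neg]
      congr 1
      simp only [heisShear_apply, heisCurve, heisMul]
      simp
      field_simp
      ring
  calc _ ≤ ENNReal.ofReal δ⁻¹ * (ENNReal.ofReal B *
        (ENNReal.ofReal 16 * (ENNReal.ofReal δ * ∫⁻ y : ℝ, decayWeight y))) := by gcongr
    _ = (ENNReal.ofReal δ⁻¹ * ENNReal.ofReal δ) * (ENNReal.ofReal B *
        (ENNReal.ofReal 16 * ∫⁻ y : ℝ, decayWeight y)) := by ring
    _ = _ := by
      rw [← ENNReal.ofReal_mul (by positivity), inv_mul_cancel₀ hδ.ne', ENNReal.ofReal_one,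
        one_mul]

theorem lintegral_comp_heisShear_isotropic {δ : ℝ} (hδ : 0 < δ) (G : HeisSpace → ℝ≥0∞) :
    ∫⁻ x, G (heisShear δ⁻¹ 1 u 0 x) = ENNReal.ofReal (δ ^ 3) * ∫⁻ w, G w := by
  have h := lintegral_comp_heisShear (R := δ⁻¹) (by positivity) one_pos u 0 G 0
  have hdet : ((1 ^ 2 * (δ⁻¹) ^ 3)⁻¹ : ℝ) = δ ^ 3 := by field_simp
  rwa [hdet, show (fun x => G (heisShear δ⁻¹ 1 u 0 (x - 0))) =
    fun x => G (heisShear δ⁻¹ 1 u 0 x) by simp] at h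

/-- Left translations preserve Lebesgue measure, so every slice has mass at most `δ ^ 3` times a
constant; the prefactor `δ⁻¹` leaves `δ ^ 2`, the cross-section of the tube. -/
theorem lintegral_enorm_tubeBump_le (hγ₂ : Continuous γ₂) (hγ₃ : Continuous γ₃)
    (hb : Continuous b) (hφ : Continuous φ) (hφ1 : ∀ w, ‖φ w‖ ≤ 1)
    (hφ0 : ∀ w, φ w ≠ 0 → ‖w‖ ≤ 1) {δ : ℝ} (hδ : 0 < δ) :
    ∫⁻ y, ‖tubeBump γ₂ γ₃ b φ u δ y‖ₑ ≤ ENNReal.ofReal (δ ^ 2) * ((∫⁻ t, ‖b t‖ₑ) *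
      volume (Metric.closedBall (0 : HeisSpace) 1)) := by
  have hinv : ‖((δ⁻¹ : ℝ) : ℂ)‖ₑ = ENNReal.ofReal δ⁻¹ := by
    rw [← ofReal_norm, Complex.norm_real, Real.norm_of_nonneg (by positivity)]
  have hc : Continuous fun q : HeisSpace × ℝ =>
      b q.2 * φ (heisShear δ⁻¹ 1 u 0 (heisMul (heisCurve γ₂ γ₃ q.2) q.1)) :=
    (hb.comp continuous_snd).mul
      (hφ.comp (continuous_heisShear_heisMul_heisCurve hγ₂ hγ₃ δ))
  calc ∫⁻ y, ‖tubeBump γ₂ γ₃ b φ u δ y‖ₑ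
      ≤ ∫⁻ y, ENNReal.ofReal δ⁻¹ * ∫⁻ t,
        ‖b t * φ (heisShear δ⁻¹ 1 u 0 (heisMul (heisCurve γ₂ γ₃ t) y))‖ₑ := by
        refine lintegral_mono fun y => ?_
        rw [tubeBump, enorm_mul, hinv]
        gcongr
        exact enorm_integral_le_lintegral_enorm _
    _ = ENNReal.ofReal δ⁻¹ * ∫⁻ t, ∫⁻ y,
        ‖b t * φ (heisShear δ⁻¹ 1 u 0 (heisMul (heisCurve γ₂ γ₃ t) y))‖ₑ := by
        rw [lintegral_const_mul' _ _ ENNReal.ofReal_ne_top,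
          lintegral_lintegral_swap hc.enorm.measurable.aemeasurable]
    _ = ENNReal.ofReal δ⁻¹ * ∫⁻ t, ‖b t‖ₑ * (ENNReal.ofReal (δ ^ 3) * ∫⁻ w, ‖φ w‖ₑ) := by
        congr 1
        refine lintegral_congr fun t => ?_
        simp_rw [enorm_mul]
        rw [lintegral_const_mul' _ _ enorm_ne_top,
          lintegral_heisMul_left (fun y => ‖φ (heisShear δ⁻¹ 1 u 0 y)‖ₑ),
          lintegral_comp_heisShear_isotropic hδ (fun w => ‖φ w‖ₑ)]
    _ = (ENNReal.ofReal δ⁻¹ * ENNReal.ofReal (δ ^ 3)) * ((∫⁻ t, ‖b t‖ₑ) * ∫⁻ w, ‖φ w‖ₑ) := by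
        rw [lintegral_mul_const _ hb.enorm.measurable]
        ring
    _ ≤ _ := by
        rw [← ENNReal.ofReal_mul (by positivity)]
        have : δ⁻¹ * δ ^ 3 = δ ^ 2 := by field_simp
        rw [this]
        gcongr
        exact lintegral_enorm_le_volume_closedBall hφ1 hφ0

theorem integral_comp_heisShear_isotropic {δ : ℝ} (hδ : 0 < δ) (G : HeisSpace → ℂ) :
    ∫ x, G (heisShear δ⁻¹ 1 u 0 x) = (δ ^ 3 : ℝ) * ∫ w, G w := by
  have h := integral_comp_heisShear (R := δ⁻¹) (by positivity) one_pos u 0 G 0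
  have hdet : ((1 ^ 2 * (δ⁻¹) ^ 3)⁻¹ : ℝ) = δ ^ 3 := by field_simp
  rwa [hdet, show (fun x => G (heisShear δ⁻¹ 1 u 0 (x - 0))) =
    fun x => G (heisShear δ⁻¹ 1 u 0 x) by simp] at h

theorem continuous_heisMul_heisInv_heisCurve (hγ₂ : Continuous γ₂) (hγ₃ : Continuous γ₃) :
    Continuous fun q : HeisSpace × ℝ => heisMul (heisInv (heisCurve γ₂ γ₃ q.2)) q.1 :=
  Continuous.comp (g := fun p : HeisSpace × HeisSpace => heisMul p.1 p.2) continuous_heisMul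
    ((((continuous_heisCurve hγ₂ hγ₃).comp continuous_snd).neg).prodMk continuous_fst)

theorem continuous_heisMul_heisCurve (hγ₂ : Continuous γ₂) (hγ₃ : Continuous γ₃) :
    Continuous fun q : HeisSpace × ℝ => heisMul (heisCurve γ₂ γ₃ q.2) q.1 :=
  Continuous.comp (g := fun p : HeisSpace × HeisSpace => heisMul p.1 p.2) continuous_heisMul
    (((continuous_heisCurve hγ₂ hγ₃).comp continuous_snd).prodMk continuous_fst)

theorem integrable_heisAverage_integrand (ha : Continuous a) (hγ₂ : Continuous γ₂)
    (hγ₃ : Continuous γ₃) {f h : HeisSpace → ℂ} (hf : Continuous f) {K : Set HeisSpace}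
    (hK : IsCompact K) (hfK : Function.support f ⊆ K) (hh : Continuous h) :
    Integrable (Function.uncurry fun (x : HeisSpace) (t : ℝ) =>
        a t * f (heisMul (heisInv (heisCurve γ₂ γ₃ t)) x) * h x)
      ((volume : Measure HeisSpace).prod (volume.restrict (Set.Icc α β))) := by
  have hK' := (hK.prod (isCompact_Icc (a := α) (b := β))).image
    (continuous_heisMul_heisCurve hγ₂ hγ₃)
  refine integrable_of_compact_support_ae
    (((ha.comp continuous_snd).mul (hf.comp (continuous_heisMul_heisInv_heisCurve hγ₂ hγ₃))).mul
      (hh.comp continuous_fst)) (hK'.prod (isCompact_Icc (a := α) (b := β))) ?_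
  have hae : ∀ᵐ t ∂(volume.restrict (Set.Icc α β)), t ∈ Set.Icc α β :=
    ae_restrict_mem measurableSet_Icc
  filter_upwards [Measure.quasiMeasurePreserving_snd.ae hae] with p hp hpK
  by_contra h0
  have h2 : f (heisMul (heisInv (heisCurve γ₂ γ₃ p.2)) p.1) ≠ 0 := by
    intro h1; apply h0; simp [Function.uncurry, h1]
  exact hpK ⟨⟨(_, p.2), ⟨hfK h2, hp⟩, heisMul_heisInv_cancel_left _ _⟩, hp⟩

theorem integrable_tube_integrand (hb : Continuous b) (hbc : HasCompactSupport b)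
    (hγ₂ : Continuous γ₂) (hγ₃ : Continuous γ₃) (hφ : Continuous φ)
    (hφ0 : ∀ w, φ w ≠ 0 → ‖w‖ ≤ 1) (hψ : Continuous ψ) {δ : ℝ} (hδ : 0 < δ) (k : ℂ)
    (t : ℝ) :
    Integrable (Function.uncurry fun (x : HeisSpace) (t' : ℝ) =>
        k * b t' * φ (heisShear δ⁻¹ 1 u 0 (heisMul (heisCurve γ₂ γ₃ t')
          (heisMul (heisInv (heisCurve γ₂ γ₃ t)) x))) * ψ (heisShear δ⁻¹ 1 u 0 x))
      ((volume : Measure HeisSpace).prod volume) := by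
  have hc1 : Continuous fun x : HeisSpace => heisMul (heisInv (heisCurve γ₂ γ₃ t)) x :=
    (continuous_heisMul_heisInv_heisCurve hγ₂ hγ₃).comp (continuous_id.prodMk continuous_const)
  have hc2 : Continuous fun q : HeisSpace × ℝ => heisShear δ⁻¹ 1 u 0
      (heisMul (heisCurve γ₂ γ₃ q.2) (heisMul (heisInv (heisCurve γ₂ γ₃ t)) q.1)) :=
    Continuous.comp (g := fun q : HeisSpace × ℝ =>
      heisShear δ⁻¹ 1 u 0 (heisMul (heisCurve γ₂ γ₃ q.2) q.1))
      (continuous_heisShear_heisMul_heisCurve hγ₂ hγ₃ δ)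
      ((hc1.comp continuous_fst).prodMk continuous_snd)
  have hc3 : Continuous fun q : HeisSpace × ℝ => heisMul (heisCurve γ₂ γ₃ t)
      (heisMul (heisInv (heisCurve γ₂ γ₃ q.2)) (heisShearInv δ⁻¹ 1 u 0 q.1)) :=
    Continuous.comp (g := fun q : HeisSpace × ℝ => heisMul (heisCurve γ₂ γ₃ q.2) q.1)
      (continuous_heisMul_heisCurve hγ₂ hγ₃)
      ((Continuous.comp (g := fun q : HeisSpace × ℝ =>
        heisMul (heisInv (heisCurve γ₂ γ₃ q.2)) q.1)
        (continuous_heisMul_heisInv_heisCurve hγ₂ hγ₃)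
        (((continuous_heisShearInv _ _ _ _).comp continuous_fst).prodMk continuous_snd)).prodMk
          continuous_const)
  have hK := ((isCompact_closedBall (0 : HeisSpace) 1).prod hbc.isCompact).image hc3
  refine integrable_of_compact_support_ae
    (((continuous_const.mul (hb.comp continuous_snd)).mul (hφ.comp hc2)).mul
      (hψ.comp ((continuous_heisShear _ _ _ _).comp continuous_fst)))
    (hK.prod hbc.isCompact) (Filter.Eventually.of_forall fun p hp => ?_)
  by_contra h0
  have h1 : b p.2 ≠ 0 := by
    intro h1; apply h0; simp [Function.uncurry, h1]
  have h2 : φ (heisShear δ⁻¹ 1 u 0 (heisMul (heisCurve γ₂ γ₃ p.2)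
      (heisMul (heisInv (heisCurve γ₂ γ₃ t)) p.1))) ≠ 0 := by
    intro h1; apply h0; simp [Function.uncurry, h1]
  have h3 := subset_tsupport _ h1
  refine hp ⟨⟨(heisShear δ⁻¹ 1 u 0 (heisMul (heisCurve γ₂ γ₃ p.2)
    (heisMul (heisInv (heisCurve γ₂ γ₃ t)) p.1)), p.2), ⟨by simpa only [mem_closedBall_zero_iff] using hφ0 _ h2, h3⟩, ?_⟩, h3⟩
  simp only
  rw [heisShearInv_heisShear (by positivity) one_ne_zero, heisInv_heisMul_cancel_left,
    heisMul_heisInv_cancel_left]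

/-- For fixed `t, t'`, invariance under the left translations by `γ(t)⁻¹` and `γ(t')` makes the
argument of `φ` the integration variable; rescaling gives `δ ^ 3`, and the prefactor of the bump
turns it into `δ ^ 2`. -/
theorem integral_tubeBump_mul (hb : Continuous b) (hbc : HasCompactSupport b)
    (hγ₂ : Continuous γ₂) (hγ₃ : Continuous γ₃) (hφ : Continuous φ)
    (hφ0 : ∀ w, φ w ≠ 0 → ‖w‖ ≤ 1) (hψ : Continuous ψ) {δ : ℝ} (hδ : 0 < δ) (k : ℂ)
    (t : ℝ) :
    ∫ x, k * tubeBump γ₂ γ₃ b φ u δ (heisMul (heisInv (heisCurve γ₂ γ₃ t)) x) *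
        ψ (heisShear δ⁻¹ 1 u 0 x) =
      (δ ^ 2 : ℝ) * ∫ w, ∫ t', k * b t' * φ w * ψ (tubeTransition γ₂ γ₃ u δ ((t, w), t')) := by
  have hY := continuous_tubeTransition (u := u) hγ₂ hγ₃ δ
  have h1 : ∀ x, k * tubeBump γ₂ γ₃ b φ u δ (heisMul (heisInv (heisCurve γ₂ γ₃ t)) x) *
      ψ (heisShear δ⁻¹ 1 u 0 x) = (δ⁻¹ : ℝ) * ∫ t',
        k * b t' * φ (heisShear δ⁻¹ 1 u 0 (heisMul (heisCurve γ₂ γ₃ t')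
          (heisMul (heisInv (heisCurve γ₂ γ₃ t)) x))) * ψ (heisShear δ⁻¹ 1 u 0 x) := by
    intro x
    have h : ∀ t', k * b t' * φ (heisShear δ⁻¹ 1 u 0 (heisMul (heisCurve γ₂ γ₃ t')
          (heisMul (heisInv (heisCurve γ₂ γ₃ t)) x))) * ψ (heisShear δ⁻¹ 1 u 0 x) =
        (k * ψ (heisShear δ⁻¹ 1 u 0 x)) * (b t' * φ (heisShear δ⁻¹ 1 u 0
          (heisMul (heisCurve γ₂ γ₃ t') (heisMul (heisInv (heisCurve γ₂ γ₃ t)) x)))) :=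
      fun t' => by ring
    simp_rw [h]
    rw [integral_const_mul, tubeBump]
    ring
  have h2 : ∀ t', ∫ x, k * b t' * φ (heisShear δ⁻¹ 1 u 0 (heisMul (heisCurve γ₂ γ₃ t')
      (heisMul (heisInv (heisCurve γ₂ γ₃ t)) x))) * ψ (heisShear δ⁻¹ 1 u 0 x) =
      (δ ^ 3 : ℝ) * ∫ w, k * b t' * φ w * ψ (tubeTransition γ₂ γ₃ u δ ((t, w), t')) := by
    intro t'
    have e1 := integral_comp_heisShear_isotropic (u := u) hδ fun w =>
      k * b t' * φ w * ψ (tubeTransition γ₂ γ₃ u δ ((t, w), t'))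
    have e2 := integral_heisMul_left (fun y => k * b t' * φ (heisShear δ⁻¹ 1 u 0 y) *
      ψ (tubeTransition γ₂ γ₃ u δ ((t, heisShear δ⁻¹ 1 u 0 y), t'))) (heisCurve γ₂ γ₃ t')
    have e3 := integral_heisMul_left (fun y => k * b t' *
      φ (heisShear δ⁻¹ 1 u 0 (heisMul (heisCurve γ₂ γ₃ t') y)) *
      ψ (tubeTransition γ₂ γ₃ u δ
        ((t, heisShear δ⁻¹ 1 u 0 (heisMul (heisCurve γ₂ γ₃ t') y)), t')))
      (heisInv (heisCurve γ₂ γ₃ t))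
    rw [← e1, ← e2, ← e3]
    congr 1
    ext x
    rw [← heisShear_eq_tubeTransition hδ]
  have hi : Integrable (Function.uncurry fun (t' : ℝ) (w : HeisSpace) =>
      k * b t' * φ w * ψ (tubeTransition γ₂ γ₃ u δ ((t, w), t')))
      ((volume : Measure ℝ).prod volume) := by
    have hc : Continuous (Function.uncurry fun (t' : ℝ) (w : HeisSpace) =>
        k * b t' * φ w * ψ (tubeTransition γ₂ γ₃ u δ ((t, w), t'))) := by
      have hc' : Continuous fun q : ℝ × HeisSpace => tubeTransition γ₂ γ₃ u δ ((t, q.2), q.1) :=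
        hY.comp (by fun_prop)
      exact ((continuous_const.mul (hb.comp continuous_fst)).mul (hφ.comp continuous_snd)).mul
        (hψ.comp hc')
    refine integrable_of_compact_support_ae hc
      (hbc.isCompact.prod (isCompact_closedBall (0 : HeisSpace) 1))
      (Filter.Eventually.of_forall fun p hp => ?_)
    by_contra h0
    have h1 : b p.1 ≠ 0 := by
      intro h1; apply h0; simp [Function.uncurry, h1]
    have h2 : φ p.2 ≠ 0 := by
      intro h1; apply h0; simp [Function.uncurry, h1]
    exact hp ⟨subset_tsupport _ h1, by simpa using hφ0 _ h2⟩
  simp_rw [h1]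
  rw [integral_const_mul, integral_integral_swap
    (integrable_tube_integrand hb hbc hγ₂ hγ₃ hφ hφ0 hψ hδ k t)]
  simp_rw [h2]
  rw [integral_const_mul, integral_integral_swap hi, ← mul_assoc, ← Complex.ofReal_mul]
  have : δ⁻¹ * δ ^ 3 = δ ^ 2 := by field_simp
  rw [this]

theorem integral_heisAverage_tubeBump_mul (ha : Continuous a) (hb : Continuous b)
    (hbc : HasCompactSupport b) (hγ₂ : Continuous γ₂) (hγ₃ : Continuous γ₃) (hφ : Continuous φ)
    (hφ1 : ∀ w, ‖φ w‖ ≤ 1) (hφ0 : ∀ w, φ w ≠ 0 → ‖w‖ ≤ 1) (hψ : Continuous ψ)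
    (hψC : ∀ y, ‖ψ y‖ * (1 + ‖y‖) ^ 4 ≤ C) {K : Set HeisSpace} (hK : IsCompact K) {δ : ℝ}
    (hδ : 0 < δ) (hfK : Function.support (tubeBump γ₂ γ₃ b φ u δ) ⊆ K) :
    ∫ x, heisAverage (heisCurve γ₂ γ₃) a α β (tubeBump γ₂ γ₃ b φ u δ) x *
        ψ (heisShear δ⁻¹ 1 u 0 x) =
      (δ ^ 3 : ℝ) * ∫ q, a q.1.1 * b (q.1.1 + δ * q.2) * φ q.1.2 *
          ψ (tubeTransition γ₂ γ₃ u δ (q.1, q.1.1 + δ * q.2))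
        ∂(((volume.restrict (Set.Icc α β)).prod volume).prod volume) := by
  have hY := continuous_tubeTransition (u := u) hγ₂ hγ₃ δ
  have hi := integrable_pairing_unscaled (α := α) (β := β) ha hb hbc hφ hφ0 hψ hY
  have hu := integral_pairing_unscaled (α := α) (β := β) ha hb hbc hφ hφ1 hφ0 hψ hψC hδ hY
    (fun p => rfl)
  have hf := continuous_tubeBump (u := u) hγ₂ hγ₃ hb hbc hφ δ
  have e : ((δ ^ 3 : ℝ) : ℂ) = (δ ^ 2 : ℝ) * δ := by push_cast; ring
  rw [e, mul_assoc, ← hu, integral_prod _ hi.integral_prod_left, ← integral_const_mul]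
  simp only [heisAverage]
  simp_rw [← integral_mul_const]
  rw [integral_integral_swap (integrable_heisAverage_integrand
    (h := fun x => ψ (heisShear δ⁻¹ 1 u 0 x)) ha hγ₂ hγ₃ hf hK hfK (hψ.comp (continuous_heisShear _ _ _ _)))]
  congr 1
  ext t
  exact integral_tubeBump_mul hb hbc hγ₂ hγ₃ hφ hφ0 hψ hδ (a t) t

/-- For `|x| ≲ δ` the points `γ(t)⁻¹ ⊙ x` run along the tube, so the `L^p` smallness of the tube is
lost under averaging. This argument needs neither curvature nor the determinant condition. -/
theorem le_one_div_of_boundedLpCompToSobolev (hγ₂ : ContDiff ℝ ∞ γ₂) (hγ₃ : ContDiff ℝ ∞ γ₃)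
    (ha : Continuous a) {t₀ : ℝ} (ht₀ : t₀ ∈ Set.Ioo α β) (ha₀ : a t₀ ≠ 0)
    {p : ℝ≥0∞} [Fact (1 ≤ p)] {s : ℝ}
    (hA : BoundedLpCompToSobolev (heisAverage (heisCurve γ₂ γ₃) a α β) p s) :
    s ≤ (1 / p).toReal := by
  have hp : 1 ≤ p := Fact.out
  obtain ⟨hθ0, hθ1⟩ := one_div_toReal_mem_Icc hp
  set θ := (1 / p).toReal with hθ
  have hγ₂c := hγ₂.continuous
  have hγ₃c := hγ₃.continuous
  have hdγ₂ : Continuous (deriv γ₂) := hγ₂.continuous_deriv (by simp)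
  have hdγ₃ : Continuous (deriv γ₃) := hγ₃.continuous_deriv (by simp)
  obtain ⟨χ, hχ, hχc, hχ0, hχpos, hχne⟩ := exists_testFunction
  obtain ⟨Cψ, hψC⟩ := exists_decay_fourier hχ hχc
  have hψ := continuous_fourier_of_contDiff hχ hχc
  -- Chosen so that at `t = t₀`, `w = 0` the limiting third coordinate vanishes for every `r`: the
  -- oscillation of the test function is transverse to the tube, and `𝓕 χ` is nonnegative along it.
  set u : ℝ := -(deriv γ₃ t₀ + 1 / 2 * (t₀ * deriv γ₂ t₀ - γ₂ t₀)) with hu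
  have hZ₀ : Continuous (tubeTransitionLimit γ₂ γ₃ u) :=
    Continuous.vec3 (by fun_prop) (by fun_prop) (by fun_prop)
  obtain ⟨b, φ, hb, hbc, hφ, hφ1, hφ0, hlow⟩ := exists_pairing_lower_bound ht₀ ha ha₀ hψ hψC hZ₀
    (fun q => rfl)
    (fun r => hχpos _ (by simp [tubeTransitionLimit, hu]; ring))
    (by
      have : tubeTransitionLimit γ₂ γ₃ u ((t₀, 0), 0) = 0 := by
        ext i; fin_cases i <;> simp [tubeTransitionLimit]
      rwa [this])
  obtain ⟨k, hk, hlow⟩ := hlow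
    (fun δ q => tubeTransition γ₂ γ₃ u δ (q.1, q.1.1 + δ * q.2))
    (fun δ _ => (continuous_tubeTransition hγ₂c hγ₃c δ).comp (by fun_prop))
    (fun δ hδ q => by
      have : δ ≠ 0 := ne_of_gt hδ
      simp only [tubeTransition]
      simp
      field_simp
      ring)
    (fun t ht w r => tendsto_tubeTransition hγ₂ hγ₃ t w r)
  obtain ⟨K, hK, hKsupp⟩ := exists_isCompact_support_tubeBump hγ₂c hγ₃c hbc hφ0 u
  obtain ⟨N, hN⟩ := hA K hK
  have hpar : Continuous fun δ : ℝ => (δ, (1 : ℝ), u, (0 : ℝ)) := by fun_prop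
  obtain ⟨C, hC0, hC⟩ := exists_decay_besselSymbol s hχ hχc hχ0
    ((isCompact_Icc (a := (0 : ℝ)) (b := 1)).image hpar)
  obtain ⟨B, hB⟩ := hb.bounded_above_of_compact_support hbc
  have hB0 : 0 ≤ B := (norm_nonneg _).trans (hB 0)
  set A₁ : ℝ := B * (16 * (∫⁻ y : ℝ, decayWeight y).toReal) with hA₁
  set V₁ : ℝ := (∫⁻ t, ‖b t‖ₑ).toReal *
    (volume (Metric.closedBall (0 : HeisSpace) 1)).toReal with hV₁
  set J : ℝ := (∫⁻ y : HeisSpace, decayWeight y).toReal with hJ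
  have hA₁0 : 0 ≤ A₁ := mul_nonneg hB0 (mul_nonneg (by norm_num) ENNReal.toReal_nonneg)
  have hV₁0 : 0 ≤ V₁ := mul_nonneg ENNReal.toReal_nonneg ENNReal.toReal_nonneg
  have hJ0 : 0 ≤ J := ENNReal.toReal_nonneg
  clear_value A₁ V₁ J θ
  -- Here `s` comes from `R ^ (-s)` with `R = δ⁻¹`, `2θ` from `‖f‖_p`, `3(1 - θ)` from the mass of a
  -- weight bounded by 1; the lower bound is of order `δ ^ 3`.
  suffices h : s + 2 * θ + 3 * (1 - θ) ≤ 3 by linarith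
  refine exponent_le_of_eventually_le (c := k)
    (D := C * (max N 0 * (A₁ ^ (1 - θ) * V₁ ^ θ)) * J ^ (1 - θ)) hk ?_
  filter_upwards [hlow, Ioc_mem_nhdsGT (zero_lt_one' ℝ)] with δ hlδ hδ
  have hδ0 : 0 < δ := hδ.1
  set f : HeisSpace → ℂ := tubeBump γ₂ γ₃ b φ u δ with hf
  have hfc : Continuous f := continuous_tubeBump hγ₂c hγ₃c hb hbc hφ δ
  have hfK : Function.support f ⊆ K := hKsupp δ hδ
  have hfL : MemLp f p volume :=
    hfc.memLp_of_hasCompactSupport (HasCompactSupport.intro hK fun x hx => by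
      by_contra h; exact hx (hfK h))
  have e1 : ENNReal.ofReal B * (ENNReal.ofReal 16 * ∫⁻ y : ℝ, decayWeight y) =
      ENNReal.ofReal A₁ := by
    rw [hA₁, ENNReal.ofReal_mul hB0, ENNReal.ofReal_mul (by norm_num),
      ENNReal.ofReal_toReal lintegral_decayWeight_real_ne_top]
  have e2 : ENNReal.ofReal (δ ^ 2) * ((∫⁻ t, ‖b t‖ₑ) *
      volume (Metric.closedBall (0 : HeisSpace) 1)) = ENNReal.ofReal (δ ^ 2 * V₁) := by
    rw [hV₁, ENNReal.ofReal_mul (by positivity), ENNReal.ofReal_mul ENNReal.toReal_nonneg,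
      ENNReal.ofReal_toReal (isCompact_closedBall _ _).measure_lt_top.ne,
      ENNReal.ofReal_toReal (lintegral_enorm_ne_top_of_hasCompactSupport hb hbc)]
  have hfn : (eLpNorm f p volume).toReal ≤ A₁ ^ (1 - θ) * (δ ^ 2 * V₁) ^ θ := by
    refine ENNReal.toReal_le_of_le_ofReal (by positivity)
      ((eLpNorm_le_of_le_of_lintegral_le (μ := volume) hp hfc.aestronglyMeasurable
        (fun y => (enorm_tubeBump_le hφ1 hφ0 hB hδ0 y).trans_eq e1)
        ((lintegral_enorm_tubeBump_le hγ₂c hγ₃c hb hφ hφ1 hφ0 hδ0).trans_eq e2)).trans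
          (le_of_eq ?_))
    rw [← hθ, ENNReal.ofReal_rpow_of_nonneg hA₁0 (by linarith),
      ENNReal.ofReal_rpow_of_nonneg (by positivity) hθ0, ← ENNReal.ofReal_mul (by positivity)]
  obtain ⟨g, hgm, hgn, hgp⟩ := exists_pairing_of_sobolevNormLE (hN f hfL hfK) hχ hχc hχ0
  have hmain := integral_heisAverage_tubeBump_mul (α := α) (β := β) (u := u) ha hb hbc hγ₂c hγ₃c
    hφ hφ1 hφ0 hψ hψC hK hδ0 hfK
  have hupper : ‖∫ x, heisAverage (heisCurve γ₂ γ₃) a α β f x *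
      𝓕 χ (heisShear δ⁻¹ 1 u 0 x)‖ₑ ≤
      ENNReal.ofReal (δ⁻¹ ^ (-s) * C) * ∫⁻ x, ‖g x‖ₑ *
        decayWeight (heisShear δ⁻¹ 1 u 0 x) := by
    have hθt : (δ⁻¹⁻¹, (1 : ℝ), u, (0 : ℝ)) ∈
        (fun δ : ℝ => (δ, (1 : ℝ), u, (0 : ℝ))) '' Set.Icc (0 : ℝ) 1 :=
      ⟨δ, Set.Ioc_subset_Icc_self hδ, by simp⟩
    have h1 := hgp δ⁻¹ 1 (by positivity) one_pos u 0 0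
    simp only [sub_zero] at h1
    have h2 : ‖((δ⁻¹ ^ (-s) : ℝ) : ℂ)‖ₑ = ENNReal.ofReal (δ⁻¹ ^ (-s)) := by
      rw [← ofReal_norm, Complex.norm_real, Real.norm_of_nonneg (by positivity)]
    rw [h1, enorm_mul, h2, ENNReal.ofReal_mul (by positivity), mul_assoc]
    refine mul_le_mul_right ?_ _
    rw [← lintegral_const_mul' _ _ ENNReal.ofReal_ne_top]
    refine (enorm_integral_le_lintegral_enorm _).trans (lintegral_mono fun x => ?_)
    rw [enorm_mul, mul_left_comm]
    gcongr
    exact hC _ hθt _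
  have hweight : ∫⁻ x, ‖g x‖ₑ * decayWeight (heisShear δ⁻¹ 1 u 0 x) ≤
      eLpNorm g p volume * (1 ^ θ * (ENNReal.ofReal (δ ^ 3 * J)) ^ (1 - θ)) := by
    rw [hθ]
    refine lintegral_enorm_mul_le_of_le hp hgm (W := fun x => decayWeight (heisShear δ⁻¹ 1 u 0 x))
      (continuous_decayWeight.comp (continuous_heisShear _ _ _ _)).measurable.aemeasurable
      (fun x => decayWeight_le_one _) ?_
    rw [lintegral_comp_heisShear_isotropic hδ0 decayWeight, hJ,
      ENNReal.ofReal_mul (by positivity),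
      ENNReal.ofReal_toReal lintegral_decayWeight_heisSpace_ne_top]
  rw [ENNReal.one_rpow, one_mul,
    ENNReal.ofReal_rpow_of_nonneg (by positivity) (by linarith)] at hweight
  have hg2 : eLpNorm g p volume ≤
      ENNReal.ofReal (max N 0 * (A₁ ^ (1 - θ) * (δ ^ 2 * V₁) ^ θ)) := by
    refine hgn.trans (ENNReal.ofReal_le_ofReal ?_)
    calc N * (eLpNorm f p volume).toReal ≤ max N 0 * (eLpNorm f p volume).toReal := by
          gcongr; exact le_max_left _ _
      _ ≤ _ := by gcongr
  have htotal : ‖∫ x, heisAverage (heisCurve γ₂ γ₃) a α β f x *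
      𝓕 χ (heisShear δ⁻¹ 1 u 0 x)‖ ≤
      (δ⁻¹ ^ (-s) * C) * ((max N 0 * (A₁ ^ (1 - θ) * (δ ^ 2 * V₁) ^ θ)) *
        (δ ^ 3 * J) ^ (1 - θ)) := by
    rw [← ENNReal.ofReal_le_ofReal_iff (by positivity), ofReal_norm,
      ENNReal.ofReal_mul (by positivity), ENNReal.ofReal_mul (p := max N 0 * _) (by positivity)]
    exact hupper.trans (mul_le_mul_right (hweight.trans (mul_le_mul_left hg2 _)) _)
  rw [hmain, norm_mul, Complex.norm_real, Real.norm_of_nonneg (by positivity)] at htotal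
  have hR : (δ⁻¹ : ℝ) ^ (-s) = δ ^ s := by
    rw [Real.inv_rpow (by positivity), Real.rpow_neg (by positivity), inv_inv]
  have h2 : ∀ x : ℝ, (δ ^ 2) ^ x = δ ^ (2 * x) := fun x => by
    rw [← Real.rpow_natCast, ← Real.rpow_mul hδ0.le]; norm_num
  have h3 : ∀ x : ℝ, (δ ^ 3) ^ x = δ ^ (3 * x) := fun x => by
    rw [← Real.rpow_natCast, ← Real.rpow_mul hδ0.le]; norm_num
  calc k * δ ^ (3 : ℝ) = δ ^ 3 * k := by
        rw [mul_comm]; congr 1; exact_mod_cast Real.rpow_natCast δ 3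
    _ ≤ δ ^ 3 * _ := by gcongr
    _ ≤ _ := htotal
    _ = _ := by
      rw [hR, Real.mul_rpow (by positivity) hV₁0, Real.mul_rpow (by positivity) hJ0, h2, h3,
        Real.rpow_add hδ0, Real.rpow_add hδ0]
      ring

end TubeExample

/-! ### Conclusion -/

theorem exists_mem_Ioo_ne_zero {α β : ℝ} (hαβ : α < β) {a : ℝ → ℂ} (ha : Continuous a)
    (ha0 : ∃ t ∈ Set.Icc α β, a t ≠ 0) : ∃ t ∈ Set.Ioo α β, a t ≠ 0 := by
  by_contra! h
  obtain ⟨t, ht, hat⟩ := ha0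
  rw [← closure_Ioo hαβ.ne] at ht
  exact hat (closure_minimal (t := {t | a t = 0}) h (isClosed_eq ha continuous_const) ht)

theorem proposition1p1 (α β : ℝ) (hαβ : α < β)
    (γ₂ γ₃ : ℝ → ℝ) (hγ₂ : ContDiff ℝ ∞ γ₂) (hγ₃ : ContDiff ℝ ∞ γ₃)
    (hcurv : ∀ t ∈ Set.Icc α β, iteratedDeriv 2 γ₂ t ≠ 0)
    (hdet : ∀ t ∈ Set.Icc α β,
      Matrix.det !![iteratedDeriv 2 γ₂ t, iteratedDeriv 2 γ₃ t;
                    iteratedDeriv 3 γ₂ t, iteratedDeriv 3 γ₃ t]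
        = 1 / 2 * (iteratedDeriv 2 γ₂ t) ^ 2)
    (a : ℝ → ℂ) (ha : ContDiff ℝ ∞ a) (ha0 : ∃ t ∈ Set.Icc α β, a t ≠ 0)
    (p : ℝ≥0∞) [Fact (1 ≤ p)] (s : ℝ)
    (hA : BoundedLpCompToSobolev (heisAverage (heisCurve γ₂ γ₃) a α β) p s) :
    s ≤ min (1 / p).toReal (1 / 2 * (1 - (1 / p).toReal)) := by
  obtain ⟨c, d, hcd⟩ := exists_deriv_eq_of_det hγ₂ hγ₃ hcurv hdet
  obtain ⟨t₀, ht₀, ha₀⟩ := exists_mem_Ioo_ne_zero hαβ ha.continuous ha0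
  exact le_min (le_one_div_of_boundedLpCompToSobolev hγ₂ hγ₃ ha.continuous ht₀ ha₀ hA)
    (le_half_of_boundedLpCompToSobolev hγ₂ hγ₃ hcd ha.continuous ht₀ ha₀ hA)
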